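/- **Theorem (Duality isomorphism of highest weight spaces).** Let $n,d,m\ge 0$ be integers, $V=(\mathbb{C}^n)^{\otimes d}$ with standard basis $e_{\mathbf i}=e_{i_1}\otimes\cdots\otimes e_{i_d}$, $\mathbf i\in[n]^d$, and let $\lambda=(\lambda^{(1)},\dots,\lambda^{(d)})$ be a $d$-tuple of partitions of $m$ such that every $\lambda^{(i)}$ and every conjugate partition $(\lambda^{(i)})'$ has at most $n$ parts. Put $\lambda'=((\lambda^{(1)})',\dots,(\lambda^{(d)})')$. *Notation.* Let $\mathrm{Sym}(v_1\otimes\cdots\otimes v_m)=\sum_{\omega\in S_m}v_{\omega(1)}\otimes\cdots\otimes v_{\omega(m)}$ and $\mathrm{Alt}(v_1\otimes\cdots\otimes v_m)=\sum_{\omega\in S_m}\mathrm{sgn}(\omega)\,v_{\omega(1)}\otimes\cdots\otimes v_{\omega(m)}$ on $\bigotimes^m V$, with images $\bigvee^m V$ and $\bigwedge^m V$. The group $\mathrm{GL}(n)^{d}$ acts on $V$ factor by factor and diagonally on $\bigotimes^m V$. For $W=\bigvee^m V$ or $\bigwedge^m V$, $\mathrm{WV}_\lambda W$ is the space of all $v\in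 W$ of weight $\lambda$ for the torus of $d$-tuples of invertible diagonal matrices, and $\mathrm{HWV}_\lambda W\subseteq \mathrm{WV}_\lambda W$ is the subspace of vectors fixed by all $d$-tuples of upper unitriangular matrices. Let $A(\lambda)$ be the set of $d\times m$ tables whose $i$-th row contains each letter $j\in[n]$ exactly $\lambda^{(i)}_j$ times, and $B(\lambda)\subseteq A(\lambda)$ the tables with pairwise distinct columns. Let $\mathsf T_{\mathbb N}(\lambda)$ and $\mathsf T_{01}(\lambda)$ be the sets of $\mathbb N$- and $(0,1)$-hypermatrices with marginals $\lambda$, identified with the tables in $A(\lambda)$, respectively $B(\lambda)$, whose columns are in lexicographic order. For a table $X$ with columns $X(1),\dots,X(m)$ put $\bigvee e_X=\mathrm{Sym}(e_{X(1)}\otimes\cdots\otimes e_{X(m)})$ and $\bigwedge e_X=\mathrm{Alt}(e_{X(1)}\otimes\cdots\otimes e_{X(m)})$. For words $s,w$ of length $m$, let $\mathrm{sgn}_s(w)$ be the product, over all letters $j$, of the sign of the subsequence $(w_{b_1},\dots,w_{b_k})$ of $w$ at the positions $b_1<\dots<b_k$ of $j$ in $s$; this sign is that of a permutation if the subsequence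 is a permutation of $[k]$, and $0$ otherwise. For tables $T,X$ with rows $t_i,x_i$ put $\mathrm{sgn}_T(X)=\prod_{i}\mathrm{sgn}_{t_i}(x_i)$, let $(-1)^T=\prod_i(-1)^{\mathrm{inv}(t_i)}$ with $\mathrm{inv}$ the number of inversions, and let $\|T\|$ be the number of column permutations in $S_m$ fixing $T$. For $T,S\in A(\lambda')$ define $$\Delta_T=\frac{(-1)^T}{\|T\|}\sum_{X\in A(\lambda)}\mathrm{sgn}_T(X)\bigvee e_X,\qquad \nabla_S=\frac{(-1)^S}{\|S\|}\sum_{Y\in B(\lambda)}\mathrm{sgn}_S(Y)\bigwedge e_Y .$$ *Statement.* (i) If $d$ is odd, there are unique linear maps $$\Delta:\mathrm{WV}_{\lambda'}\textstyle\bigwedge^m V\to \mathrm{HWV}_{\lambda}\bigvee^m V,\quad \bigwedge e_T\mapsto\Delta_T\ \ (T\in\mathsf T_{01}(\lambda')),$$ $$\nabla:\mathrm{WV}_{\lambda'}\textstyle\bigvee^m V\to \mathrm{HWV}_{\lambda}\bigwedge^m V,\quad \bigvee e_S\mapsto\nabla_S\ \ (S\in\mathsf T_{\mathbb N}(\lambda')).$$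 Both are surjective, and they restrict to linear isomorphisms $\mathrm{HWV}_{\lambda'}\bigwedge^m V\to\mathrm{HWV}_{\lambda}\bigvee^m V$ and $\mathrm{HWV}_{\lambda'}\bigvee^m V\to\mathrm{HWV}_{\lambda}\bigwedge^m V$, respectively. (ii) If $d$ is even, there are unique linear maps $$\Delta:\mathrm{WV}_{\lambda'}\textstyle\bigvee^m V\to \mathrm{HWV}_{\lambda}\bigvee^m V,\quad \bigvee e_S\mapsto\Delta_S\ \ (S\in\mathsf T_{\mathbb N}(\lambda')),$$ $$\nabla:\mathrm{WV}_{\lambda'}\textstyle\bigwedge^m V\to \mathrm{HWV}_{\lambda}\bigwedge^m V,\quad \bigwedge e_T\mapsto\nabla_T\ \ (T\in\mathsf T_{01}(\lambda')).$$ Both are surjective, and they restrict to linear isomorphisms $\mathrm{HWV}_{\lambda'}\bigvee^m V\to\mathrm{HWV}_{\lambda}\bigvee^m V$ and $\mathrm{HWV}_{\lambda'}\bigwedge^m V\to\mathrm{HWV}_{\lambda}\bigwedge^m V$, respectively. -/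

import Mathlib

open scoped TensorProduct

noncomputable section

/-- The space `V = (ℂ^n)^{⊗ d}`. -/
abbrev TensorV (n d : ℕ) : Type := ⨂[ℂ] _ : Fin d, (Fin n → ℂ)

/-- The space `⨂^m V` with `V = (ℂ^n)^{⊗ d}`. -/
abbrev TensorPow (n d m : ℕ) : Type := ⨂[ℂ] _ : Fin m, TensorV n d

/-! ### Tables of words -/

/-- A `d × m` table with letters in `[n]` (letters are counted from `0`), given by its
columns: `X k i` is the entry in column `k` and row `i`. -/
abbrev Table (n d m : ℕ) : Type := Fin m → Fin d → Fin n

/-- Conjugation of a tuple of partitions, coordinate by coordinate. -/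
def conjTuple {d : ℕ} (lam : Fin d → YoungDiagram) : Fin d → YoungDiagram :=
  fun i => (lam i).transpose

/-- `A(lam)`: the tables whose `i`-th row contains the letter `j` exactly `lam i j` times. -/
def tablesN (n m : ℕ) {d : ℕ} (lam : Fin d → YoungDiagram) : Set (Table n d m) :=
  {X | ∀ (i : Fin d) (j : Fin n),
    (Finset.univ.filter fun k : Fin m => X k i = j).card = (lam i).rowLen j}

/-- `B(lam)`: the tables in `A(lam)` without repeating columns. -/
def tables01 (n m : ℕ) {d : ℕ} (lam : Fin d → YoungDiagram) : Set (Table n d m) :=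
  {X | X ∈ tablesN n m lam ∧ Function.Injective X}

/-- The columns of the table are ordered lexicographically. -/
def IsLex {n d m : ℕ} (X : Table n d m) : Prop :=
  Monotone fun k : Fin m => toLex (X k)

/-- `A^lex(lam)`: the `d`-line notations of `ℕ`-hypermatrices with marginals `lam`. -/
def lexTablesN (n m : ℕ) {d : ℕ} (lam : Fin d → YoungDiagram) : Set (Table n d m) :=
  {X | X ∈ tablesN n m lam ∧ IsLex X}

/-- `B^lex(lam)`: the `d`-line notations of `(0,1)`-hypermatrices with marginals `lam`. -/
def lexTables01 (n m : ℕ) {d : ℕ} (lam : Fin d → YoungDiagram) : Set (Table n d m) :=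
  {X | X ∈ tables01 n m lam ∧ IsLex X}

/-! ### Signs -/

/-- The sign of the sequence `a` if it is a permutation of `0, …, k - 1`, and `0` otherwise
(at most one summand is nonzero). -/
def seqSign {k : ℕ} (a : Fin k → ℕ) : ℤ := by
  classical
  exact ∑ p : Equiv.Perm (Fin k),
    if ∀ i, a i = (p i : ℕ) then (Equiv.Perm.sign p : ℤ) else 0

/-- The block of the letter `j` in the word `s`: the set of its positions. -/
def block {n m : ℕ} (s : Fin m → Fin n) (j : Fin n) : Finset (Fin m) :=
  Finset.univ.filter fun k => s k = j

/-- `sgn_s(w)`: the product over the blocks of `s` of the signs of the restrictions of `w`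
to these blocks, each read in increasing order of positions. -/
def wordSgn {n m : ℕ} (s w : Fin m → Fin n) : ℤ :=
  ∏ j : Fin n, seqSign fun p : Fin (block s j).card =>
    (w ((block s j).orderEmbOfFin rfl p) : ℕ)

/-- `sgn_T(X)`: the product of the signs over the rows. -/
def tableSgn {n d m : ℕ} (T X : Table n d m) : ℤ :=
  ∏ i : Fin d, wordSgn (fun k => T k i) (fun k => X k i)

/-- The number of inversions of a word. -/
def invNum {n m : ℕ} (w : Fin m → Fin n) : ℕ :=
  (Finset.univ.filter fun p : Fin m × Fin m => p.1 < p.2 ∧ w p.2 < w p.1).card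

/-- The sign `(-1)^T`, the product over the rows of `(-1)` to the number of inversions. -/
def invSign {n d m : ℕ} (T : Table n d m) : ℤ :=
  ∏ i : Fin d, (-1) ^ invNum (fun k => T k i)

/-- `||T||`: the number of column permutations fixing the table `T`. -/
def stabSize {n d m : ℕ} (T : Table n d m) : ℕ :=
  Nat.card {p : Equiv.Perm (Fin m) // T ∘ p = T}

/-! ### Symmetric and alternating tensors -/

/-- `Sym (v₁ ⊗ … ⊗ v_m) = ∑_ω v_{ω(1)} ⊗ … ⊗ v_{ω(m)}`, without a factor `1 / m!`. -/
def symOp (n d m : ℕ) : TensorPow n d m →ₗ[ℂ] TensorPow n d m :=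
  ∑ w : Equiv.Perm (Fin m),
    (PiTensorProduct.reindex ℂ (fun _ : Fin m => TensorV n d) w.symm).toLinearMap

/-- `Alt (v₁ ⊗ … ⊗ v_m) = ∑_ω sgn(ω) v_{ω(1)} ⊗ … ⊗ v_{ω(m)}`, without a factor `1 / m!`. -/
def altOp (n d m : ℕ) : TensorPow n d m →ₗ[ℂ] TensorPow n d m :=
  ∑ w : Equiv.Perm (Fin m), ((Equiv.Perm.sign w : ℤ) : ℂ) •
    (PiTensorProduct.reindex ℂ (fun _ : Fin m => TensorV n d) w.symm).toLinearMap

/-- `⋁^m V`, the image of `Sym`. -/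
def symPow (n d m : ℕ) : Submodule ℂ (TensorPow n d m) := LinearMap.range (symOp n d m)

/-- `⋀^m V`, the image of `Alt`. -/
def altPow (n d m : ℕ) : Submodule ℂ (TensorPow n d m) := LinearMap.range (altOp n d m)

/-- The standard basis tensor `e_c = e_{c_1} ⊗ … ⊗ e_{c_d}` of `V`. -/
def stdTensor {n d : ℕ} (c : Fin d → Fin n) : TensorV n d :=
  PiTensorProduct.tprod ℂ fun i => (Pi.single (c i) (1 : ℂ) : Fin n → ℂ)

/-- `⋁ e_X = e_{X(1)} ∨ … ∨ e_{X(m)}`. -/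
def veeVec {n d m : ℕ} (X : Table n d m) : TensorPow n d m :=
  symOp n d m (PiTensorProduct.tprod ℂ fun k => stdTensor (X k))

/-- `⋀ e_X = e_{X(1)} ∧ … ∧ e_{X(m)}`. -/
def wedgeVec {n d m : ℕ} (X : Table n d m) : TensorPow n d m :=
  altOp n d m (PiTensorProduct.tprod ℂ fun k => stdTensor (X k))

/-! ### The action of `GL(n)^d` and (highest) weight spaces -/

/-- The action on `⨂^m (ℂ^n)^{⊗ d}` of a tuple of matrices `(g_1, …, g_d)`: diagonal in the
`m` factors, and `g_i` acts on the `i`-th factor of `(ℂ^n)^{⊗ d}`. -/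
def act {n d : ℕ} (m : ℕ) (g : Fin d → Matrix (Fin n) (Fin n) ℂ) :
    TensorPow n d m →ₗ[ℂ] TensorPow n d m :=
  PiTensorProduct.map fun _ : Fin m =>
    PiTensorProduct.map fun i : Fin d => (g i).mulVecLin

/-- `WV_lam W`: the vectors `v` of `W` with `t · v = t^lam v` for every `t` in the torus of
tuples of invertible diagonal matrices. -/
def weightSpace {n d m : ℕ} (W : Submodule ℂ (TensorPow n d m))
    (lam : Fin d → YoungDiagram) : Submodule ℂ (TensorPow n d m) where
  carrier := {v | v ∈ W ∧ ∀ t : Fin d → Fin n → ℂˣ,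
    act m (fun i => Matrix.diagonal fun j => (t i j : ℂ)) v =
      (∏ i : Fin d, ∏ j : Fin n, (t i j : ℂ) ^ (lam i).rowLen j) • v}
  add_mem' := fun {a b} ha hb =>
    ⟨W.add_mem ha.1 hb.1, fun t => by rw [map_add, ha.2 t, hb.2 t, smul_add]⟩
  zero_mem' := ⟨W.zero_mem, fun t => by rw [map_zero, smul_zero]⟩
  smul_mem' := fun c x hx =>
    ⟨W.smul_mem c hx.1, fun t => by rw [map_smul, hx.2 t, smul_comm]⟩

/-- Upper triangular matrices with ones on the diagonal. -/
def IsUnitriangular {n : ℕ} (M : Matrix (Fin n) (Fin n) ℂ) : Prop :=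
  (∀ j, M j j = 1) ∧ ∀ i j, j < i → M i j = 0

/-- `HWV_lam W`: the vectors of `WV_lam W` fixed by all tuples of unitriangular matrices. -/
def highestWeightSpace {n d m : ℕ} (W : Submodule ℂ (TensorPow n d m))
    (lam : Fin d → YoungDiagram) : Submodule ℂ (TensorPow n d m) where
  carrier := {v | v ∈ weightSpace W lam ∧ ∀ u : Fin d → Matrix (Fin n) (Fin n) ℂ,
    (∀ i, IsUnitriangular (u i)) → act m u v = v}
  add_mem' := fun {a b} ha hb =>
    ⟨Submodule.add_mem _ ha.1 hb.1, fun u hu => by rw [map_add, ha.2 u hu, hb.2 u hu]⟩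
  zero_mem' := ⟨Submodule.zero_mem _, fun u _ => map_zero _⟩
  smul_mem' := fun c x hx =>
    ⟨Submodule.smul_mem _ c hx.1, fun u hu => by rw [map_smul, hx.2 u hu]⟩

theorem highestWeightSpace_le {n d m : ℕ} (W : Submodule ℂ (TensorPow n d m))
    (lam : Fin d → YoungDiagram) : highestWeightSpace W lam ≤ weightSpace W lam :=
  fun _ hv => hv.1

/-! ### The vectors `Δ_T` and `∇_S`, and the index maps -/

open Classical in
/-- `Δ_T = (-1)^T / ||T|| * ∑_{X ∈ A(lam)} sgn_T(X) ⋁ e_X`, for tables `T` of weight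
conjugate to `lam`. -/
def deltaVec {n d m : ℕ} (lam : Fin d → YoungDiagram) (T : Table n d m) : TensorPow n d m :=
  ((invSign T : ℂ) / (stabSize T : ℂ)) •
    ∑ X ∈ Finset.univ.filter (fun X : Table n d m => X ∈ tablesN n m lam),
      (tableSgn T X : ℂ) • veeVec X

open Classical in
/-- `∇_S = (-1)^S / ||S|| * ∑_{Y ∈ B(lam)} sgn_S(Y) ⋀ e_Y`, for tables `S` of weight
conjugate to `lam`. -/
def nablaVec {n d m : ℕ} (lam : Fin d → YoungDiagram) (S : Table n d m) : TensorPow n d m :=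
  ((invSign S : ℂ) / (stabSize S : ℂ)) •
    ∑ Y ∈ Finset.univ.filter (fun Y : Table n d m => Y ∈ tables01 n m lam),
      (tableSgn S Y : ℂ) • wedgeVec Y

/-- `Φ` maps the vector `e T` to the vector `f T`, for all tables `T` in the index set `I`
(in particular, all these `e T` lie in the domain of `Φ`). -/
def IsIndexMap {n d m : ℕ} {P Q : Submodule ℂ (TensorPow n d m)} (I : Set (Table n d m))
    (e f : Table n d m → TensorPow n d m) (Φ : P →ₗ[ℂ] Q) : Prop :=
  ∀ T ∈ I, ∃ h : e T ∈ P, (Φ ⟨e T, h⟩ : TensorPow n d m) = f T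

end

/-! All four maps come from one operator `D` on `⨂^m V`, sending `e_T` to `‖T‖⁻¹ ∑_X K(T,X) e_X`.
The kernel `K(T,X)` is the product over the rows of the sign with which `k ↦ (t_k, x_k)` enumerates
the boxes of the conjugate diagram, and zero if some row is not such an enumeration. Writing each
sign as a determinant (`boxSgn`) makes everything computable; on tables of weight `λ'` it equals
`(-1)^T sgn_T(X)` (`IsBoxEnum.neg_one_pow_invNum_mul_wordSgn`).

Permuting the columns of `T` and `X` together by `w` multiplies `K` by `sgn(w)^d`. Hence `D` carries
the `χ`-isotypic tensors to the `χ·sgn^d`-isotypic ones: it exchanges symmetric and alternating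
tensors for odd `d` and preserves them for even `d`.

Image. Each `K(T,·)` is a highest weight vector of weight `λ`, because a unitriangular substitution
multiplies the determinants by unitriangular ones (`IsBoxEnum.sum_unitriangular`). Conversely these
vectors span: in the leading table of a highest weight vector every row is a lattice word, by an
`sl₂` norm argument (`isLattice_of_raise_eq_zero`); each table of weight `λ` with lattice rows is
the leading table of some `K(T,·)` (`IsBoxEnum.exists_leading`); so leading terms can be cancelled
one after another (`mem_range_rowsSgnMap`). Averaging over `S_m` gives surjectivity on the weight
spaces.

Injectivity on highest weight vectors. Conjugating the diagrams transposes `K` up to one global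
sign. So a highest weight vector `v` of weight `λ'` has the form `±Kᵀc`, and if `D v = K(r v) = 0`
with `r = ‖·‖⁻¹ > 0`, then `⟨v, r v⟩ = ±⟨c, K(r v)⟩ = 0`, whence `v = 0`. The same holds with `λ`
and `λ'` interchanged, so the two highest weight spaces have equal dimension and the restriction is
bijective. -/

noncomputable section

/-! ### Box signs and their unitriangular invariance -/

/-- The sign of the arrangement `k ↦ (t k, x k)` of the boxes enumerated by `b`, written as the
determinant of an incidence matrix; it vanishes unless the arrangement is a bijection. -/
def boxSgn {n m : ℕ} (b : Fin m → Fin n × Fin n) (t x : Fin m → Fin n) : ℤ :=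
  (Matrix.of fun k l : Fin m => if b l = (t k, x k) then (1 : ℤ) else 0).det

/-- `b` enumerates the boxes of `μ` in lexicographic order, and all of them lie in `[n] × [n]`. -/
structure IsBoxEnum {n m : ℕ} (μ : YoungDiagram) (b : Fin m → Fin n × Fin n) : Prop where
  strictMono : StrictMono fun l => toLex (b l)
  mem_iff : ∀ i j : Fin n, ((i : ℕ), (j : ℕ)) ∈ μ ↔ ∃ l, b l = (i, j)
  fits : ∀ i j : ℕ, (i, j) ∈ μ → i < n ∧ j < n

theorem IsBoxEnum.injective {n m : ℕ} {μ : YoungDiagram} {b : Fin m → Fin n × Fin n}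
    (hb : IsBoxEnum μ b) : Function.Injective b :=
  fun _ _ h => hb.strictMono.injective (congrArg toLex h)

theorem IsBoxEnum.apply_mem {n m : ℕ} {μ : YoungDiagram} {b : Fin m → Fin n × Fin n}
    (hb : IsBoxEnum μ b) (l : Fin m) : (((b l).1 : ℕ), ((b l).2 : ℕ)) ∈ μ :=
  (hb.mem_iff _ _).2 ⟨l, rfl⟩

theorem exists_isBoxEnum {n m : ℕ} (μ : YoungDiagram) (hcard : μ.card = m)
    (hcol : μ.colLen 0 ≤ n) (hrow : μ.rowLen 0 ≤ n) :
    ∃ b : Fin m → Fin n × Fin n, IsBoxEnum μ b := by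
  classical
  have hfit : ∀ i j : ℕ, (i, j) ∈ μ → i < n ∧ j < n := fun i j h =>
    ⟨((YoungDiagram.mem_iff_lt_colLen.1 h).trans_le (μ.colLen_anti 0 j (Nat.zero_le _))).trans_le
      hcol,
     ((YoungDiagram.mem_iff_lt_rowLen.1 h).trans_le (μ.rowLen_anti 0 i (Nat.zero_le _))).trans_le
      hrow⟩
  let s : Finset (Fin n ×ₗ Fin n) :=
    Finset.univ.filter fun p => (((ofLex p).1 : ℕ), ((ofLex p).2 : ℕ)) ∈ μ
  have hs : s.card = m := by
    rw [← hcard]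
    refine Finset.card_bij (fun p _ => (((ofLex p).1 : ℕ), ((ofLex p).2 : ℕ))) ?_ ?_ ?_
    · intro p hp
      exact (Finset.mem_filter.1 hp).2
    · intro p _ q _ h
      simp only [Prod.mk.injEq] at h
      exact ofLex.injective (Prod.ext (Fin.ext h.1) (Fin.ext h.2))
    · rintro ⟨i, j⟩ h
      have := hfit i j h
      exact ⟨toLex (⟨i, this.1⟩, ⟨j, this.2⟩), by simpa [s] using h, rfl⟩
  refine ⟨fun l => ofLex (s.orderEmbOfFin hs l), ?_, ?_, hfit⟩
  · intro l l' h
    simpa using h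
  · intro i j
    have := Finset.range_orderEmbOfFin s hs
    have h2 : toLex (i, j) ∈ Set.range (s.orderEmbOfFin hs) ↔ toLex (i, j) ∈ s := by
      rw [this]; rfl
    have h3 : toLex (i, j) ∈ s ↔ ((i : ℕ), (j : ℕ)) ∈ μ := by simp [s]
    rw [← h3, ← h2]
    rfl

section
variable {n m : ℕ} {b : Fin m → Fin n × Fin n}

theorem boxSgn_eq_sign (hb : Function.Injective b) {t x : Fin m → Fin n}
    (σ : Equiv.Perm (Fin m)) (h : ∀ k, b (σ k) = (t k, x k)) :
    boxSgn b t x = Equiv.Perm.sign σ := by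
  have : (Matrix.of fun k l : Fin m => if b l = (t k, x k) then (1 : ℤ) else 0) =
      (1 : Matrix (Fin m) (Fin m) ℤ).submatrix σ id := by
    ext k l
    simp [Matrix.one_apply, ← h, hb.eq_iff, eq_comm]
  rw [boxSgn, this, Matrix.det_permute]
  simp

theorem exists_perm_of_boxSgn_ne_zero {t x : Fin m → Fin n} (h : boxSgn b t x ≠ 0) :
    ∃ σ : Equiv.Perm (Fin m), ∀ k, b (σ k) = (t k, x k) := by
  rw [boxSgn, Matrix.det_apply] at h
  obtain ⟨σ, -, hσ⟩ := Finset.exists_ne_zero_of_sum_ne_zero h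
  refine ⟨σ⁻¹, fun k => ?_⟩
  by_contra hk
  apply hσ
  rw [Finset.prod_eq_zero (Finset.mem_univ (σ⁻¹ k)), smul_zero]
  simpa using hk

theorem boxSgn_comp_perm (b : Fin m → Fin n × Fin n) (t x : Fin m → Fin n)
    (σ : Equiv.Perm (Fin m)) :
    boxSgn b (t ∘ σ) (x ∘ σ) = Equiv.Perm.sign σ * boxSgn b t x := by
  rw [boxSgn, boxSgn, ← Int.cast_id (n := (Equiv.Perm.sign σ : ℤ)), ← Matrix.det_permute]
  rfl

theorem boxSgn_swap {b b' : Fin m → Fin n × Fin n} (π : Equiv.Perm (Fin m))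
    (h : ∀ l, b' l = (b (π l)).swap) (t x : Fin m → Fin n) :
    boxSgn b' x t = Equiv.Perm.sign π * boxSgn b t x := by
  rw [boxSgn, boxSgn, ← Int.cast_id (n := (Equiv.Perm.sign π : ℤ)), ← Matrix.det_permute']
  congr 1
  ext k l
  simp [h, Prod.ext_iff, and_comm]

theorem IsBoxEnum.exists_perm_of_injective {μ : YoungDiagram} (hb : IsBoxEnum μ b)
    {t x : Fin m → Fin n} (hmem : ∀ k, ((t k : ℕ), (x k : ℕ)) ∈ μ)
    (hinj : ∀ k l, t k = t l → x k = x l → k = l) :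
    ∃ σ : Equiv.Perm (Fin m), ∀ k, b (σ k) = (t k, x k) := by
  choose f hf using fun k => (hb.mem_iff (t k) (x k)).1 (hmem k)
  have hinj' : Function.Injective f := fun k l hkl => by
    have := (hf k).symm.trans ((congrArg b hkl).trans (hf l))
    exact hinj k l (congrArg Prod.fst this) (congrArg Prod.snd this)
  exact ⟨Equiv.ofBijective f (Finite.injective_iff_bijective.1 hinj'), hf⟩

/-- Reflecting the diagram only reorders the boxes, that is, the columns of the determinant. The
resulting sign does not depend on `t` and `x`, so the kernel of the conjugate diagram is the
transposed kernel up to a constant. -/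
theorem IsBoxEnum.exists_transpose {μ : YoungDiagram} {b' : Fin m → Fin n × Fin n}
    (hb : IsBoxEnum μ b) (hb' : IsBoxEnum μ.transpose b') :
    ∃ ε : ℤˣ, ∀ t x : Fin m → Fin n, boxSgn b' x t = ε * boxSgn b t x := by
  obtain ⟨π, hπ⟩ := hb.exists_perm_of_injective (t := fun k => (b' k).2) (x := fun k => (b' k).1)
    (fun k => by simpa using hb'.apply_mem k)
    (fun k l h1 h2 => hb'.injective (Prod.ext h2 h1))
  exact ⟨Equiv.Perm.sign π, boxSgn_swap π fun l => by rw [hπ]; rfl⟩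

theorem IsBoxEnum.card_fst {μ : YoungDiagram} (hb : IsBoxEnum μ b) {t x : Fin m → Fin n}
    (h : boxSgn b t x ≠ 0) (j : Fin n) :
    (Finset.univ.filter fun k => t k = j).card = μ.rowLen j := by
  obtain ⟨σ, hσ⟩ := exists_perm_of_boxSgn_ne_zero h
  rw [YoungDiagram.rowLen_eq_card]
  refine Finset.card_bij (fun k _ => ((t k : ℕ), (x k : ℕ))) ?_ ?_ ?_
  · intro k hk
    rw [YoungDiagram.mem_row_iff]
    have := hb.apply_mem (σ k)
    rw [hσ] at this
    exact ⟨this, by rw [← (Finset.mem_filter.1 hk).2]⟩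
  · intro k _ l _ hkl
    simp only [Prod.mk.injEq] at hkl
    have : b (σ k) = b (σ l) := by
      rw [hσ, hσ]; exact Prod.ext (Fin.ext hkl.1) (Fin.ext hkl.2)
    exact σ.injective (hb.injective this)
  · rintro ⟨i, r⟩ hir
    rw [YoungDiagram.mem_row_iff] at hir
    obtain ⟨hir, rfl⟩ := hir
    obtain ⟨l, hl⟩ := (hb.mem_iff j ⟨r, (hb.fits _ _ hir).2⟩).1 hir
    have h2 := hσ (σ.symm l)
    rw [Equiv.apply_symm_apply, hl] at h2
    simp only [Prod.mk.injEq] at h2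
    refine ⟨σ.symm l, by simp [h2.1], ?_⟩
    rw [← h2.1, ← h2.2]

theorem IsBoxEnum.card_snd {μ : YoungDiagram} (hb : IsBoxEnum μ b) {t x : Fin m → Fin n}
    (h : boxSgn b t x ≠ 0) (j : Fin n) :
    (Finset.univ.filter fun k => x k = j).card = μ.transpose.rowLen j := by
  obtain ⟨σ, hσ⟩ := exists_perm_of_boxSgn_ne_zero h
  rw [YoungDiagram.rowLen_transpose, YoungDiagram.colLen_eq_card]
  refine Finset.card_bij (fun k _ => ((t k : ℕ), (x k : ℕ))) ?_ ?_ ?_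
  · intro k hk
    rw [YoungDiagram.mem_col_iff]
    have := hb.apply_mem (σ k)
    rw [hσ] at this
    exact ⟨this, by rw [← (Finset.mem_filter.1 hk).2]⟩
  · intro k _ l _ hkl
    simp only [Prod.mk.injEq] at hkl
    have : b (σ k) = b (σ l) := by
      rw [hσ, hσ]; exact Prod.ext (Fin.ext hkl.1) (Fin.ext hkl.2)
    exact σ.injective (hb.injective this)
  · rintro ⟨r, i⟩ hir
    rw [YoungDiagram.mem_col_iff] at hir
    obtain ⟨hir, rfl⟩ := hir
    obtain ⟨l, hl⟩ := (hb.mem_iff ⟨r, (hb.fits _ _ hir).1⟩ j).1 hir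
    have h2 := hσ (σ.symm l)
    rw [Equiv.apply_symm_apply, hl] at h2
    simp only [Prod.mk.injEq] at h2
    refine ⟨σ.symm l, by simp [h2.2], ?_⟩
    rw [← h2.1, ← h2.2]

/-- The matrix of `u` acting on the second coordinates of the boxes preserves the rows of the
diagram; in the lexicographic order of the boxes it is upper unitriangular. -/
theorem det_eq_one_of_isBoxEnum {μ : YoungDiagram} (hb : IsBoxEnum μ b)
    {u : Matrix (Fin n) (Fin n) ℂ} (hu : IsUnitriangular u) :
    (Matrix.of fun l l' : Fin m =>
      if (b l).1 = (b l').1 then u (b l).2 (b l').2 else 0).det = 1 := by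
  rw [Matrix.det_of_isUpperTriangular]
  · exact Finset.prod_eq_one fun l _ => by simp [hu.1]
  · intro l l' hl
    have hl : l' < l := hl
    simp only [Matrix.of_apply]
    split_ifs with h
    · refine hu.2 _ _ ?_
      have := hb.strictMono hl
      rw [Prod.Lex.toLex_lt_toLex] at this
      rcases this with h' | h'
      · exact absurd h h'.ne'
      · exact h'.2
    · rfl

/-- By multilinearity in the matrix rows, the left side is one determinant whose `k`-th row
substitutes `u` into the second coordinate. This matrix factors as the incidence matrix of `(t, x)`
times the unitriangular matrix of `det_eq_one_of_isBoxEnum`. The factorization needs `μ` to be a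
Young diagram. -/
theorem IsBoxEnum.sum_unitriangular {μ : YoungDiagram} (hb : IsBoxEnum μ b)
    {u : Matrix (Fin n) (Fin n) ℂ} (hu : IsUnitriangular u) (t x : Fin m → Fin n) :
    ∑ y : Fin m → Fin n, (∏ k, u (x k) (y k)) * (boxSgn b t y : ℂ) = boxSgn b t x := by
  classical
  set M : (Fin m → Fin n) → Matrix (Fin m) (Fin m) ℂ := fun y =>
    Matrix.of fun k l => if b l = (t k, y k) then (1 : ℂ) else 0 with hM
  set U : Matrix (Fin m) (Fin m) ℂ := Matrix.of fun l l' =>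
    if (b l).1 = (b l').1 then u (b l).2 (b l').2 else 0 with hU
  have hcast : ∀ y, (boxSgn b t y : ℂ) = (M y).det := fun y => by
    have := RingHom.map_det (Int.castRingHom ℂ)
      (Matrix.of fun k l : Fin m => if b l = (t k, y k) then (1 : ℤ) else 0)
    rw [boxSgn]
    refine this.trans ?_
    congr 1
    ext k l
    simp [hM]
  have hMU : M x * U = Matrix.of fun k l => if (b l).1 = t k then u (x k) (b l).2 else 0 := by
    ext k l'
    rw [Matrix.mul_apply, Matrix.of_apply]
    by_cases hk : ∃ l, b l = (t k, x k)
    · obtain ⟨l, hl⟩ := hk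
      rw [Finset.sum_eq_single l]
      · simp [hM, hU, hl, eq_comm]
      · intro l₂ _ hne
        have : b l₂ ≠ (t k, x k) := fun h => hne (hb.injective (h.trans hl.symm))
        simp [hM, this]
      · simp
    · rw [Finset.sum_eq_zero]
      · split_ifs with h
        · symm
          refine hu.2 _ _ ?_
          -- Here `(t k, x k)` lies outside the diagram. Rows of a diagram have no gaps, so every
          -- box in row `t k` is strictly to the left of column `x k`, where `u` vanishes.
          by_contra hle
          refine hk ((hb.mem_iff _ _).1 (μ.up_left_mem ?_ ?_ (hb.apply_mem l')))
          · rw [h]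
          · exact not_lt.1 hle
        · rfl
      · intro l _
        have : b l ≠ (t k, x k) := fun h => hk ⟨l, h⟩
        simp [hM, this]
  have hdet : (boxSgn b t x : ℂ) =
      (Matrix.of fun k l => if (b l).1 = t k then u (x k) (b l).2 else 0).det := by
    rw [hcast, ← hMU, Matrix.det_mul, det_eq_one_of_isBoxEnum hb hu, mul_one]
  rw [hdet, Matrix.det_apply]
  simp_rw [hcast, Matrix.det_apply, Finset.mul_sum]
  rw [Finset.sum_comm]
  refine Finset.sum_congr rfl fun σ _ => ?_
  simp_rw [mul_smul_comm]
  rw [← Finset.smul_sum]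
  congr 1
  have h1 : ∀ y : Fin m → Fin n, (∏ k, u (x k) (y k)) * ∏ i, M y (σ i) i =
      ∏ k, u (x k) (y k) * (if b (σ.symm k) = (t k, y k) then (1 : ℂ) else 0) := fun y => by
    have h := Equiv.prod_comp σ (fun k => if b (σ.symm k) = (t k, y k) then (1 : ℂ) else 0)
    rw [Finset.prod_mul_distrib, ← h]
    simp [hM]
  have h2 : ∏ i, (Matrix.of fun k l => if (b l).1 = t k then u (x k) (b l).2 else 0) (σ i) i =
      ∏ k, ∑ a, u (x k) a * (if b (σ.symm k) = (t k, a) then (1 : ℂ) else 0) := by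
    rw [← Equiv.prod_comp σ (fun k => ∑ a, _)]
    refine Finset.prod_congr rfl fun i _ => ?_
    simp only [Matrix.of_apply, Equiv.symm_apply_apply, Prod.ext_iff]
    by_cases h : (b i).1 = t (σ i)
    · simp [h]
    · simp [h]
  rw [h2, Finset.prod_univ_sum, Fintype.piFinset_univ]
  exact Finset.sum_congr rfl fun y _ => h1 y

end

/-! ### Box signs as inversion signs of words -/

section
variable {n m : ℕ} {b : Fin m → Fin n × Fin n}

theorem sign_eq_prod_inversions {k : ℕ} (σ : Equiv.Perm (Fin k)) :
    (Equiv.Perm.sign σ : ℤ) = ∏ i, ∏ j, if i < j ∧ σ j < σ i then (-1 : ℤ) else 1 := by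
  rw [Equiv.Perm.sign_eq_prod_prod_Ioi, Units.coe_prod]
  refine Finset.prod_congr rfl fun i _ => ?_
  rw [Units.coe_prod, ← Finset.prod_subset (Finset.subset_univ (Finset.Ioi i))]
  · refine Finset.prod_congr rfl fun j hj => ?_
    have hij : i < j := Finset.mem_Ioi.1 hj
    rcases lt_or_gt_of_ne (σ.injective.ne hij.ne) with h | h
    · simp [h, h.not_gt]
    · simp [h, h.not_gt, hij]
  · intro j _ hj
    simp [Finset.mem_Ioi.not.1 hj]

theorem neg_one_pow_invNum (w : Fin m → Fin n) :
    (-1 : ℤ) ^ invNum w = ∏ i, ∏ j, if i < j ∧ w j < w i then (-1 : ℤ) else 1 := by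
  rw [← Fintype.prod_prod_type' (f := fun i j => if i < j ∧ w j < w i then (-1 : ℤ) else 1),
    Finset.prod_ite, Finset.prod_const, Finset.prod_const_one, mul_one, invNum]

theorem seqSign_eq_sign {k : ℕ} {a : Fin k → ℕ} (p : Equiv.Perm (Fin k))
    (h : ∀ i, a i = (p i : ℕ)) : seqSign a = Equiv.Perm.sign p := by
  rw [seqSign, Finset.sum_eq_single p]
  · simp [h]
  · intro q _ hq
    rw [if_neg]
    intro hq'
    exact hq (Equiv.ext fun i => Fin.ext ((hq' i).symm.trans (h i)))
  · simp

theorem exists_perm_of_seqSign_ne_zero {k : ℕ} {a : Fin k → ℕ} (h : seqSign a ≠ 0) :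
    ∃ p : Equiv.Perm (Fin k), ∀ i, a i = (p i : ℕ) := by
  obtain ⟨p, -, hp⟩ := Finset.exists_ne_zero_of_sum_ne_zero h
  exact ⟨p, by by_contra hn; exact hp (if_neg hn)⟩

theorem prod_block (s : Fin m → Fin n) (j : Fin n) (f : Fin m → ℤ) :
    ∏ p : Fin (block s j).card, f ((block s j).orderEmbOfFin rfl p) = ∏ k ∈ block s j, f k := by
  conv_rhs => rw [← Finset.map_orderEmbOfFin_univ (block s j) rfl, Finset.prod_map]
  rfl

theorem exists_orderEmbOfFin_block (s : Fin m → Fin n) (k : Fin m) :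
    ∃ p, (block s (s k)).orderEmbOfFin rfl p = k := by
  have : k ∈ Set.range ((block s (s k)).orderEmbOfFin rfl) := by
    rw [Finset.range_orderEmbOfFin]; simp [block]
  exact this

theorem orderEmbOfFin_block (s : Fin m → Fin n) (j : Fin n) (p : Fin (block s j).card) :
    s ((block s j).orderEmbOfFin rfl p) = j :=
  (Finset.mem_filter.1 ((block s j).orderEmbOfFin_mem rfl p)).2

theorem wordSgn_eq_prod {s w : Fin m → Fin n}
    (h : ∀ j, ∃ p : Equiv.Perm (Fin (block s j).card), ∀ i,
      (w ((block s j).orderEmbOfFin rfl i) : ℕ) = (p i : ℕ)) :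
    wordSgn s w =
      ∏ k, ∏ l, if k < l ∧ s l = s k ∧ w l < w k then (-1 : ℤ) else 1 := by
  have h1 : ∀ j : Fin n, seqSign (fun p : Fin (block s j).card =>
      (w ((block s j).orderEmbOfFin rfl p) : ℕ)) =
      ∏ k ∈ block s j, ∏ l, if k < l ∧ s l = s k ∧ w l < w k then (-1 : ℤ) else 1 := by
    intro j
    obtain ⟨p, hp⟩ := h j
    rw [seqSign_eq_sign p hp, sign_eq_prod_inversions, ← prod_block]
    refine Finset.prod_congr rfl fun i _ => ?_
    rw [← Finset.prod_subset (Finset.subset_univ (block s j)), ← prod_block]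
    · refine Finset.prod_congr rfl fun i' _ => ?_
      simp only [OrderEmbedding.lt_iff_lt, orderEmbOfFin_block, true_and]
      simp only [Fin.lt_def, hp]
    · intro l _ hl
      rw [if_neg]
      rintro ⟨-, hl', -⟩
      rw [orderEmbOfFin_block s] at hl'
      exact hl (by simp [block, hl'])
  rw [wordSgn, Finset.prod_congr rfl fun j _ => h1 j]
  exact Finset.prod_fiberwise Finset.univ s _

/-- The inversions of the enumerating permutation with respect to the lexicographic order are of two
kinds: those of `t`, and those of `x` inside a block of `t`. The content condition makes the blocks
as long as the rows of `μ`, so that both sides vanish for the same `x`. -/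
theorem IsBoxEnum.neg_one_pow_invNum_mul_wordSgn {μ : YoungDiagram} (hb : IsBoxEnum μ b)
    {t : Fin m → Fin n}
    (ht : ∀ j : Fin n, (Finset.univ.filter fun k => t k = j).card = μ.rowLen j)
    (x : Fin m → Fin n) :
    (-1) ^ invNum t * wordSgn t x = boxSgn b t x := by
  by_cases hσ : ∃ σ : Equiv.Perm (Fin m), ∀ k, b (σ k) = (t k, x k)
  · obtain ⟨σ, hσ⟩ := hσ
    have hmem : ∀ k, ((t k : ℕ), (x k : ℕ)) ∈ μ := fun k => by
      have := hb.apply_mem (σ k); rwa [hσ] at this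
    have hperm : ∀ j, ∃ p : Equiv.Perm (Fin (block t j).card), ∀ i,
        (x ((block t j).orderEmbOfFin rfl i) : ℕ) = (p i : ℕ) := by
      intro j
      have hlt : ∀ i, (x ((block t j).orderEmbOfFin rfl i) : ℕ) < (block t j).card := by
        intro i
        have := YoungDiagram.mem_iff_lt_rowLen.1 (hmem ((block t j).orderEmbOfFin rfl i))
        rw [orderEmbOfFin_block t, ← ht] at this
        exact this
      have hinj : Function.Injective fun i : Fin (block t j).card =>
          (⟨x ((block t j).orderEmbOfFin rfl i), hlt i⟩ : Fin (block t j).card) := by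
        intro i i' hi
        have hx := Fin.ext (Fin.mk.inj_iff.1 hi)
        refine ((block t j).orderEmbOfFin rfl).injective (σ.injective (hb.injective ?_))
        rw [hσ, hσ, hx, orderEmbOfFin_block t, orderEmbOfFin_block t]
      exact ⟨Equiv.ofBijective _ (Finite.injective_iff_bijective.1 hinj), fun i => rfl⟩
    rw [boxSgn_eq_sign hb.injective σ hσ, sign_eq_prod_inversions, wordSgn_eq_prod hperm,
      neg_one_pow_invNum, ← Finset.prod_mul_distrib]
    refine Finset.prod_congr rfl fun k _ => ?_
    rw [← Finset.prod_mul_distrib]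
    refine Finset.prod_congr rfl fun l _ => ?_
    have hlt : σ l < σ k ↔ t l < t k ∨ t l = t k ∧ x l < x k := by
      rw [← hb.strictMono.lt_iff_lt, hσ, hσ, Prod.Lex.toLex_lt_toLex]
    simp only [hlt]
    by_cases hkl : k < l
    · rcases lt_trichotomy (t l) (t k) with h | h | h
      · simp [hkl, h, h.ne]
      · simp [hkl, h]
      · simp [h.not_gt, h.ne']
    · simp [hkl]
  · have h1 : boxSgn b t x = 0 := by
      by_contra h; exact hσ (exists_perm_of_boxSgn_ne_zero h)
    rw [h1, mul_eq_zero]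
    right
    by_contra h
    have hp : ∀ j, ∃ p : Equiv.Perm (Fin (block t j).card), ∀ i,
        (x ((block t j).orderEmbOfFin rfl i) : ℕ) = (p i : ℕ) := fun j =>
      exists_perm_of_seqSign_ne_zero (Finset.prod_ne_zero_iff.1 h j (Finset.mem_univ j))
    choose p hp using hp
    refine hσ (hb.exists_perm_of_injective (fun k => ?_) fun k l htkl hx => ?_)
    · obtain ⟨i, hi⟩ := exists_orderEmbOfFin_block t k
      have := hp (t k) i
      rw [hi] at this
      rw [YoungDiagram.mem_iff_lt_rowLen, this, ← ht]
      exact (p (t k) i).2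
    · obtain ⟨i, hi⟩ := exists_orderEmbOfFin_block t k
      obtain ⟨i', hi'⟩ : ∃ p, (block t (t k)).orderEmbOfFin rfl p = l := by
        rw [htkl]; exact exists_orderEmbOfFin_block t l
      have h1 := hp (t k) i
      have h2 := hp (t k) i'
      rw [hi] at h1
      rw [hi', ← hx, h1] at h2
      rw [← hi, ← hi', (p (t k)).injective (Fin.ext h2)]

/-! ### Lattice words -/

/-- The number of letters `a` among the first `p` letters of `x`. -/
def prefixCount (x : Fin m → Fin n) (p : ℕ) (a : Fin n) : ℕ :=
  (Finset.univ.filter fun k : Fin m => (k : ℕ) < p ∧ x k = a).card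

/-- Lattice words: no prefix contains a letter more often than a smaller letter. -/
def IsLattice (x : Fin m → Fin n) : Prop :=
  ∀ (p : ℕ) (a b : Fin n), a < b → prefixCount x p b ≤ prefixCount x p a

theorem prefixCount_mono (x : Fin m → Fin n) (a : Fin n) {p q : ℕ} (h : p ≤ q) :
    prefixCount x p a ≤ prefixCount x q a :=
  Finset.card_le_card fun k hk => by
    simp only [Finset.mem_filter, Finset.mem_univ, true_and] at hk ⊢
    exact ⟨hk.1.trans_le h, hk.2⟩

theorem prefixCount_lt (x : Fin m → Fin n) {k : Fin m} {q : ℕ} (h : (k : ℕ) < q) :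
    prefixCount x k (x k) < prefixCount x q (x k) := by
  refine Finset.card_lt_card ((Finset.ssubset_iff_of_subset ?_).2 ⟨k, ?_, ?_⟩)
  · intro l hl
    simp only [Finset.mem_filter, Finset.mem_univ, true_and] at hl ⊢
    exact ⟨hl.1.trans h, hl.2⟩
  · simp [h]
  · simp

theorem prefixCount_lt_card (x : Fin m → Fin n) (k : Fin m) :
    prefixCount x k (x k) < (Finset.univ.filter fun l => x l = x k).card := by
  refine (prefixCount_lt x k.2).trans_le (Finset.card_le_card fun l hl => ?_)
  simp only [Finset.mem_filter, Finset.mem_univ, true_and] at hl ⊢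
  exact hl.2

/-- In a lattice word the `r`-th occurrence of a letter precedes the `r`-th occurrence of every
larger letter. -/
theorem IsLattice.lt_of_prefixCount_eq {x : Fin m → Fin n} (hx : IsLattice x) {k l : Fin m}
    (h : prefixCount x l (x l) = prefixCount x k (x k)) (hlt : x k < x l) : k < l := by
  by_contra hkl
  rcases (not_lt.1 hkl).lt_or_eq with h' | h'
  · have h1 := prefixCount_lt x (Nat.lt_succ_self (l : ℕ))
    have h2 := hx (l + 1) _ _ hlt
    have h3 := prefixCount_mono x (x k) (Nat.succ_le_of_lt (Fin.lt_def.1 h'))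
    simp only [Nat.succ_eq_add_one] at h1 h3
    omega
  · rw [h'] at hlt
    exact lt_irrefl _ hlt

theorem toColex_lt_toColex_iff {x y : Fin m → Fin n} :
    toColex x < toColex y ↔ ∃ k, (∀ l, k < l → x l = y l) ∧ x k < y k :=
  Iff.rfl

/-- Put each letter of `x` into the next free box of the column it names, and let `t` record the
rows used. The lattice property makes `x` increasing on each block of `t`. The words `y` with
nonzero sign rearrange `x` inside these blocks, so none of them is colexicographically larger. -/
theorem IsBoxEnum.exists_leading {μ : YoungDiagram} (hb : IsBoxEnum μ b) {x : Fin m → Fin n}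
    (hx : IsLattice x)
    (hwt : ∀ j : Fin n, (Finset.univ.filter fun k => x k = j).card = μ.transpose.rowLen j) :
    ∃ t, boxSgn b t x ≠ 0 ∧ ∀ y, boxSgn b t y ≠ 0 → toColex y ≤ toColex x := by
  have hmem : ∀ k : Fin m, (prefixCount x k (x k), (x k : ℕ)) ∈ μ := fun k => by
    rw [YoungDiagram.mem_iff_lt_colLen, ← YoungDiagram.rowLen_transpose, ← hwt]
    exact prefixCount_lt_card x k
  have hinj : ∀ k l : Fin m, prefixCount x k (x k) = prefixCount x l (x l) → x k = x l → k = l := by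
    intro k l h hkl
    rcases lt_trichotomy k l with h' | h' | h'
    · have := prefixCount_lt x (Fin.lt_def.1 h')
      rw [h, hkl] at this
      exact absurd this (lt_irrefl _)
    · exact h'
    · have := prefixCount_lt x (Fin.lt_def.1 h')
      rw [← h, hkl] at this
      exact absurd this (lt_irrefl _)
  let t : Fin m → Fin n := fun k => ⟨prefixCount x k (x k), (hb.fits _ _ (hmem k)).1⟩
  obtain ⟨σ, hσ⟩ := hb.exists_perm_of_injective (t := t) (x := x) hmem
    (fun k l h1 h2 => hinj k l (Fin.mk.inj_iff.1 h1) h2)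
  refine ⟨t, ?_, fun y hy => ?_⟩
  · rw [boxSgn_eq_sign hb.injective σ hσ]
    exact Units.ne_zero _
  · obtain ⟨τ, hτ⟩ := exists_perm_of_boxSgn_ne_zero hy
    by_contra hle
    obtain ⟨k, hk, hlt⟩ := toColex_lt_toColex_iff.1 (not_le.1 hle)
    have hl : b (σ (σ.symm (τ k))) = (t k, y k) := by rw [Equiv.apply_symm_apply, hτ]
    set l := σ.symm (τ k)
    rw [hσ] at hl
    simp only [Prod.mk.injEq] at hl
    -- At the last difference `k`, the larger letter `y k` occurs in `x` in the same block at some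
    -- `l`. As `l` comes after `k`, the words agree there, and `y` uses one box twice.
    have hkl : k < l := hx.lt_of_prefixCount_eq (congrArg Fin.val hl.1) (hl.2.symm ▸ hlt)
    have : b (τ l) = b (τ k) := by rw [hτ, hτ, hl.1, ← hl.2, ← hk l hkl]
    exact hkl.ne' (τ.injective (hb.injective this))

end

/-! ### Raising operators, and leading words of highest weight vectors -/

section
variable {n m : ℕ}

open Function in
-- Raising at one position commutes with lowering at another. This removes the off-diagonal terms
-- from the commutator identity below.
theorem sum_update_comm {k l : Fin m} (hkl : k ≠ l) {a b : Fin n}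
    (g c : (Fin m → Fin n) → ℂ) :
    ∑ w : Fin m → Fin n, (if w k = b then g (update w k a) else 0) *
      (if w l = b then c (update w l a) else 0) =
    ∑ w : Fin m → Fin n, (if w l = a then g (update w l b) else 0) *
      (if w k = a then c (update w k b) else 0) := by
  simp only [ite_mul, zero_mul, mul_ite, mul_zero, ← ite_and]
  rw [← Finset.sum_filter, ← Finset.sum_filter]
  refine Finset.sum_nbij' (fun w => update (update w k a) l a)
    (fun w => update (update w k b) l b) ?_ ?_ ?_ ?_ ?_
  · intro w hw
    simp [hkl]
  · intro w hw
    simp [hkl]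
  · intro w hw
    obtain ⟨hk, hl⟩ := (Finset.mem_filter.1 hw).2
    ext j
    by_cases h1 : j = l
    · subst h1; simp [*]
    · by_cases h2 : j = k
      · subst h2; simp [*]
      · simp [h1, h2]
  · intro w hw
    obtain ⟨hk, hl⟩ := (Finset.mem_filter.1 hw).2
    ext j
    by_cases h1 : j = l
    · subst h1; simp [*]
    · by_cases h2 : j = k
      · subst h2; simp [*]
      · simp [h1, h2]
  · intro w hw
    obtain ⟨hk, hl⟩ := (Finset.mem_filter.1 hw).2
    congr 2
    · ext j
      by_cases h1 : j = l
      · subst h1; simp [hkl.symm, *]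
      · by_cases h2 : j = k
        · subst h2; simp [*]
        · simp [h1, h2]
    · ext j
      by_cases h1 : j = l
      · subst h1; simp [hkl.symm]
      · by_cases h2 : j = k
        · subst h2; simp [*]
        · simp [h1, h2]

open Function in
theorem sum_update_self (k : Fin m) (a b : Fin n) (f : (Fin m → Fin n) → ℂ) :
    ∑ w : Fin m → Fin n, (if w k = b then f (update w k a) else 0) =
      ∑ w : Fin m → Fin n, if w k = a then f w else 0 := by
  rw [← Finset.sum_filter, ← Finset.sum_filter]
  refine Finset.sum_nbij' (fun w => update w k a) (fun w => update w k b) ?_ ?_ ?_ ?_ ?_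
  · intro w hw; simp
  · intro w hw; simp
  · intro w hw
    simp only [Finset.mem_filter, Finset.mem_univ, true_and] at hw
    rw [update_idem, ← hw, update_eq_self]
  · intro w hw
    simp only [Finset.mem_filter, Finset.mem_univ, true_and] at hw
    rw [update_idem, ← hw, update_eq_self]
  · intro w hw; rfl

open Function in
/-- The commutator relation of the raising and lowering operators on the positions in `P`, in the
form of an identity between norms. -/
theorem sum_lower_add_eq_sum_raise_add (P : Finset (Fin m)) (a b : Fin n)
    (g c : (Fin m → Fin n) → ℂ) :
    ∑ w : Fin m → Fin n, (∑ k ∈ P, if w k = b then g (update w k a) else 0) *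
        (∑ l ∈ P, if w l = b then c (update w l a) else 0) +
      ∑ w : Fin m → Fin n, ((P.filter fun k => w k = b).card : ℂ) * (g w * c w) =
    ∑ w : Fin m → Fin n, (∑ k ∈ P, if w k = a then g (update w k b) else 0) *
        (∑ l ∈ P, if w l = a then c (update w l b) else 0) +
      ∑ w : Fin m → Fin n, ((P.filter fun k => w k = a).card : ℂ) * (g w * c w) := by
  have expand : ∀ a b : Fin n,
      ∑ w : Fin m → Fin n, (∑ k ∈ P, if w k = b then g (update w k a) else 0) *
        (∑ l ∈ P, if w l = b then c (update w l a) else 0) =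
      ∑ k ∈ P, ∑ l ∈ P, ∑ w : Fin m → Fin n, (if w k = b then g (update w k a) else 0) *
        (if w l = b then c (update w l a) else 0) := by
    intro a b
    simp_rw [Finset.sum_mul_sum]
    rw [Finset.sum_comm]
    exact Finset.sum_congr rfl fun k _ => Finset.sum_comm
  have diag : ∀ a b : Fin n, ∀ k, ∑ w : Fin m → Fin n,
      (if w k = b then g (update w k a) else 0) * (if w k = b then c (update w k a) else 0) =
      ∑ w : Fin m → Fin n, if w k = a then g w * c w else 0 := by
    intro a b k
    rw [← sum_update_self k a b]
    refine Finset.sum_congr rfl fun w _ => ?_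
    split_ifs <;> simp
  have count : ∀ b : Fin n,
      ∑ w : Fin m → Fin n, ((P.filter fun k => w k = b).card : ℂ) * (g w * c w) =
      ∑ k ∈ P, ∑ l ∈ P, if k = l then ∑ w : Fin m → Fin n, (if w k = b then g w * c w else 0)
        else 0 := by
    intro b
    simp_rw [Finset.sum_ite_eq]
    rw [Finset.sum_congr rfl fun k hk => if_pos hk, Finset.sum_comm]
    refine Finset.sum_congr rfl fun w _ => ?_
    rw [← Finset.sum_filter, Finset.sum_const, nsmul_eq_mul]
  rw [expand a b, expand b a, count a, count b, Finset.sum_comm (s := P) (t := P)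
    (f := fun k l => ∑ w : Fin m → Fin n, (if w k = a then g (update w k b) else 0) *
        (if w l = a then c (update w l b) else 0)), ← Finset.sum_add_distrib,
    ← Finset.sum_add_distrib]
  refine Finset.sum_congr rfl fun k _ => ?_
  rw [← Finset.sum_add_distrib, ← Finset.sum_add_distrib]
  refine Finset.sum_congr rfl fun l _ => ?_
  by_cases hkl : k = l
  · subst hkl
    rw [if_pos rfl, if_pos rfl, diag, diag, add_comm]
  · rw [if_neg hkl, if_neg hkl, sum_update_comm hkl]

open Function in
/-- A vector of negative weight that is annihilated by a raising operator vanishes. -/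
theorem eq_zero_of_raise_eq_zero (P : Finset (Fin m)) {a b : Fin n} {p q : ℕ} (hpq : p < q)
    {g : (Fin m → Fin n) → ℂ}
    (hraise : ∀ w, (∑ k ∈ P, if w k = a then g (update w k b) else 0) = 0)
    (ha : ∀ w, g w ≠ 0 → (P.filter fun k => w k = a).card = p)
    (hb : ∀ w, g w ≠ 0 → (P.filter fun k => w k = b).card = q) : g = 0 := by
  -- With `E` the raising operator, `F` its adjoint and `E g = 0`, the commutator identity paired
  -- with the conjugate of `g` reads `‖F g‖² + q‖g‖² = p‖g‖²`, which forces `g = 0` since `p < q`.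
  have key := sum_lower_add_eq_sum_raise_add P a b g (fun w => star (g w))
  have hcount : ∀ (x : Fin n) (r : ℕ),
      (∀ w, g w ≠ 0 → (P.filter fun k => w k = x).card = r) →
      ∑ w : Fin m → Fin n, ((P.filter fun k => w k = x).card : ℂ) * (g w * star (g w)) =
        ((r * ∑ w, ‖g w‖ ^ 2 : ℝ) : ℂ) := by
    intro x r hr
    push_cast
    rw [Finset.mul_sum]
    refine Finset.sum_congr rfl fun w _ => ?_
    by_cases hw : g w = 0
    · simp [hw]
    · rw [hr w hw]
      congr 1
      exact Complex.mul_conj' (g w)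
  have hlow : ∑ w : Fin m → Fin n, (∑ k ∈ P, if w k = b then g (update w k a) else 0) *
        (∑ l ∈ P, if w l = b then star (g (update w l a)) else 0) =
      ((∑ w : Fin m → Fin n, ‖∑ k ∈ P, if w k = b then g (update w k a) else 0‖ ^ 2 : ℝ) : ℂ) := by
    push_cast
    refine Finset.sum_congr rfl fun w _ => ?_
    rw [← Complex.mul_conj', map_sum]
    congr 1
    refine Finset.sum_congr rfl fun k _ => ?_
    split_ifs <;> simp
  rw [hcount a p ha, hcount b q hb, hlow] at key
  simp only [hraise, zero_mul, Finset.sum_const_zero, zero_add] at key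
  norm_cast at key
  have h1 : 0 ≤ ∑ w : Fin m → Fin n,
      ‖∑ k ∈ P, if w k = b then g (update w k a) else 0‖ ^ 2 :=
    Finset.sum_nonneg fun _ _ => by positivity
  have h2 : 0 ≤ ∑ w, ‖g w‖ ^ 2 := Finset.sum_nonneg fun _ _ => by positivity
  have hpq' : (p : ℝ) + 1 ≤ q := by exact_mod_cast hpq
  have h3 : ∑ w, ‖g w‖ ^ 2 = 0 := by nlinarith
  ext w
  have := (Finset.sum_eq_zero_iff_of_nonneg fun w _ => by positivity).1 h3 w (Finset.mem_univ w)
  simpa using this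

open Function in
-- Suppose a prefix of `x` contains `b` more often than a smaller letter `a`. Let `g` be the part of
-- `h` on words agreeing with `x` after this prefix. Maximality of `x` makes `g` annihilated by the
-- raising operator on the prefix positions alone, while its `sl₂`-weight is negative; so `g = 0`,
-- although `g x = h x ≠ 0`.
theorem isLattice_of_raise_eq_zero {h : (Fin m → Fin n) → ℂ} {wt : Fin n → ℕ}
    (hwt : ∀ w, h w ≠ 0 → ∀ j, (Finset.univ.filter fun k => w k = j).card = wt j)
    (hraise : ∀ a b, a < b → ∀ w, (∑ k, if w k = a then h (update w k b) else 0) = 0)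
    {x : Fin m → Fin n} (hx : h x ≠ 0) (hmax : ∀ y, h y ≠ 0 → toColex y ≤ toColex x) :
    IsLattice x := by
  intro p a b hab
  by_contra hlt
  rw [not_le] at hlt
  classical
  set P : Finset (Fin m) := Finset.univ.filter fun k => (k : ℕ) < p with hP
  set g : (Fin m → Fin n) → ℂ := fun w => if ∀ k ∉ P, w k = x k then h w else 0 with hg
  have hcount : ∀ (c : Fin n) (w), g w ≠ 0 → (P.filter fun k => w k = c).card =
      prefixCount x p c := by
    intro c w hw
    have hw1 : ∀ k ∉ P, w k = x k := by
      by_contra hn; exact hw (if_neg hn)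
    have hw2 : h w ≠ 0 := by
      intro h0; apply hw; simp [hg, h0]
    have e1 := (hwt w hw2 c).trans (hwt x hx c).symm
    have split : ∀ y : Fin m → Fin n, (Finset.univ.filter fun k => y k = c).card =
        (P.filter fun k => y k = c).card + (Pᶜ.filter fun k => y k = c).card := by
      intro y
      rw [← Finset.card_union_of_disjoint, ← Finset.filter_union, Finset.union_compl]
      exact Finset.disjoint_filter_filter disjoint_compl_right
    have e2 : (Pᶜ.filter fun k => w k = c) = Pᶜ.filter fun k => x k = c :=
      Finset.filter_congr fun k hk => by rw [hw1 k (Finset.mem_compl.1 hk)]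
    rw [split w, split x, e2] at e1
    have e3 : prefixCount x p c = (P.filter fun k => x k = c).card := by
      rw [prefixCount, hP, Finset.filter_filter]
    omega
  have hg0 : g = 0 := by
    refine eq_zero_of_raise_eq_zero P hlt (a := a) (b := b) (fun w => ?_) (hcount a) (hcount b)
    by_cases hw : ∀ k ∉ P, w k = x k
    · refine Eq.trans ?_ (hraise a b hab w)
      rw [← Finset.sum_subset (Finset.subset_univ P)]
      · refine Finset.sum_congr rfl fun k hk => ?_
        split_ifs with hka
        · refine if_pos fun l hl => ?_
          rw [update_of_ne (fun e : l = k => hl (e ▸ hk)), hw l hl]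
        · rfl
      · intro k _ hk
        split_ifs with hka
        · by_contra hne
          refine (hmax _ hne).not_gt (toColex_lt_toColex_iff.2 ⟨k, fun l hl => ?_, ?_⟩)
          · rw [update_of_ne hl.ne', hw]
            simp only [hP, Finset.mem_filter, Finset.mem_univ, true_and, not_lt] at hk ⊢
            exact hk.trans (Fin.lt_def.1 hl).le
          · rw [update_self, ← hw k hk, hka]
            exact hab
        · rfl
    · refine Finset.sum_eq_zero fun k hk => ?_
      split_ifs with hka
      · refine if_neg fun hw' => hw fun l hl => ?_
        have := hw' l hl
        rwa [update_of_ne (fun e : l = k => hl (e ▸ hk))] at this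
      · rfl
  have : g x = h x := if_pos fun k _ => rfl
  rw [hg0] at this
  exact hx this.symm

open Function in
-- Compare weights in the invariance under `1 + E_ab`. If the sum is nonzero, `w` has one letter `a`
-- too many, so `h w = 0`, and in the expansion only words with exactly one `a` replaced by `b` have
-- the right weight to contribute.
theorem raise_eq_zero_of_unitriangular {h : (Fin m → Fin n) → ℂ} {wt : Fin n → ℕ}
    (hwt : ∀ w, h w ≠ 0 → ∀ j, (Finset.univ.filter fun k => w k = j).card = wt j)
    (hinv : ∀ u : Matrix (Fin n) (Fin n) ℂ, IsUnitriangular u →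
      ∀ w, ∑ y : Fin m → Fin n, (∏ k, u (w k) (y k)) * h y = h w)
    (a b : Fin n) (hab : a < b) (w : Fin m → Fin n) :
    (∑ k, if w k = a then h (update w k b) else 0) = 0 := by
  classical
  by_contra hne
  obtain ⟨k₀, -, hk₀⟩ := Finset.exists_ne_zero_of_sum_ne_zero hne
  have hk₀a : w k₀ = a := by
    by_contra h'; exact hk₀ (if_neg h')
  rw [if_pos hk₀a] at hk₀
  have hcount : (Finset.univ.filter fun k => w k = a).card = wt a + 1 := by
    rw [← hwt _ hk₀ a, ← Finset.card_insert_of_notMem (a := k₀) (by simp [hab.ne'])]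
    congr 1
    ext k
    by_cases hk : k = k₀
    · subst hk; simp [hk₀a]
    · simp [hk]
  have hw0 : h w = 0 := by
    by_contra h'
    have := hwt w h' a
    omega
  set u : Matrix (Fin n) (Fin n) ℂ := fun i j => if i = j ∨ i = a ∧ j = b then 1 else 0 with hu
  have hutri : IsUnitriangular u := by
    refine ⟨fun j => by simp [hu], fun i j hij => if_neg ?_⟩
    rintro (h' | ⟨h1, h2⟩)
    · exact hij.ne' h'
    · rw [h1, h2] at hij
      exact hab.not_gt hij
  apply hne
  refine Eq.trans ?_ ((hinv u hutri w).trans hw0)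
  rw [← Finset.sum_filter]
  have hinj : Set.InjOn (fun k => update w k b)
      ((Finset.univ.filter fun k => w k = a : Finset (Fin m)) : Set (Fin m)) := by
    intro k hk l hl hkl
    by_contra hne'
    have := congrFun hkl k
    simp only [Finset.coe_filter, Finset.mem_univ, true_and, Set.mem_ofPred_eq] at hk
    simp only [update_self, update_of_ne hne', hk] at this
    exact hab.ne' this
  rw [← Finset.sum_image (f := h) hinj, ← Finset.sum_subset (Finset.subset_univ
    ((Finset.univ.filter fun k => w k = a).image fun k => update w k b))]
  · refine Finset.sum_congr rfl fun y hy => ?_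
    obtain ⟨k, hk, rfl⟩ := Finset.mem_image.1 hy
    rw [Finset.prod_eq_one, one_mul]
    intro l _
    by_cases hl : l = k
    · subst hl; simp [hu, (Finset.mem_filter.1 hk).2]
    · simp [hu, hl]
  · intro y _ hy
    by_contra hy0
    have h1 := Finset.prod_ne_zero_iff.1 (left_ne_zero_of_mul hy0)
    have h2 := hwt y (right_ne_zero_of_mul hy0) a
    have h3 : ∀ k, w k = y k ∨ w k = a ∧ y k = b := fun k => by
      by_contra h'; exact h1 k (Finset.mem_univ k) (if_neg h')
    have hsub : (Finset.univ.filter fun k => y k = a) ⊆ Finset.univ.filter fun k => w k = a := by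
      intro k hk
      simp only [Finset.mem_filter, Finset.mem_univ, true_and] at hk ⊢
      rcases h3 k with h | h
      · rw [h, hk]
      · exact h.1
    have hcard := Finset.card_sdiff_of_subset hsub
    rw [hcount, h2, Nat.add_sub_cancel_left, Finset.card_eq_one] at hcard
    obtain ⟨k, hk⟩ := hcard
    have hk' : ∀ l, w l = a ∧ y l ≠ a ↔ l = k := fun l => by
      have := Finset.ext_iff.1 hk l
      simpa using this
    refine hy (Finset.mem_image.2 ⟨k, by simpa using ((hk' k).2 rfl).1, ?_⟩)
    ext1 l
    by_cases hl : l = k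
    · subst hl
      rw [update_self]
      rcases h3 l with h | h
      · exact absurd (h.symm.trans ((hk' l).2 rfl).1) ((hk' l).2 rfl).2
      · exact h.2.symm
    · rw [update_of_ne hl]
      rcases h3 l with h | h
      · exact h
      · exact absurd ((hk' l).1 ⟨h.1, h.2 ▸ hab.ne'⟩) hl

end

/-! ### Highest weight functions on tables: spanning and nondegeneracy -/

section
variable {n d m : ℕ}

/-- The product over the rows of the signs of the box arrangements. -/
def rowsSgn (b : Fin d → Fin m → Fin n × Fin n) (T X : Fin d → Fin m → Fin n) : ℤ :=
  ∏ i, boxSgn (b i) (T i) (X i)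

/-- The linear map with matrix entries `rowsSgn b T X`, on functions on tables given by rows. -/
def rowsSgnMap (b : Fin d → Fin m → Fin n × Fin n) :
    ((Fin d → Fin m → Fin n) → ℂ) →ₗ[ℂ] ((Fin d → Fin m → Fin n) → ℂ) :=
  Matrix.mulVecLin (Matrix.of fun X T => (rowsSgn b T X : ℂ))

/-- The action of a tuple of matrices in coordinates. -/
def actFun (m : ℕ) (g : Fin d → Matrix (Fin n) (Fin n) ℂ) :
    ((Fin d → Fin m → Fin n) → ℂ) →ₗ[ℂ] ((Fin d → Fin m → Fin n) → ℂ) :=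
  Matrix.mulVecLin (Matrix.of fun X Y => ∏ i, ∏ k, g i (X i k) (Y i k))

theorem rowsSgnMap_apply (b : Fin d → Fin m → Fin n × Fin n) (c : (Fin d → Fin m → Fin n) → ℂ)
    (X : Fin d → Fin m → Fin n) : rowsSgnMap b c X = ∑ T, (rowsSgn b T X : ℂ) * c T := rfl

theorem actFun_apply (g : Fin d → Matrix (Fin n) (Fin n) ℂ) (f : (Fin d → Fin m → Fin n) → ℂ)
    (X : Fin d → Fin m → Fin n) :
    actFun m g f X = ∑ Y, (∏ i, ∏ k, g i (X i k) (Y i k)) * f Y := rfl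

/-- Functions supported on the tables of weight `lam`. -/
def weightFun (n m : ℕ) (lam : Fin d → YoungDiagram) :
    Submodule ℂ ((Fin d → Fin m → Fin n) → ℂ) where
  carrier := {f | ∀ X, f X ≠ 0 → ∀ i (j : Fin n),
    (Finset.univ.filter fun k => X i k = j).card = (lam i).rowLen j}
  add_mem' := fun {f g} hf hg X hX => by
    by_cases h : f X = 0
    · exact hg X (by simpa [h] using hX)
    · exact hf X h
  zero_mem' := fun X hX => absurd rfl hX
  smul_mem' := fun c f hf X hX => hf X (right_ne_zero_of_mul hX)

/-- Functions of weight `lam` that are fixed by the tuples of unitriangular matrices. -/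
def highestWeightFun (n m : ℕ) (lam : Fin d → YoungDiagram) :
    Submodule ℂ ((Fin d → Fin m → Fin n) → ℂ) where
  carrier := {f | f ∈ weightFun n m lam ∧ ∀ u : Fin d → Matrix (Fin n) (Fin n) ℂ,
    (∀ i, IsUnitriangular (u i)) → actFun m u f = f}
  add_mem' := fun hf hg => ⟨add_mem hf.1 hg.1, fun u hu => by rw [map_add, hf.2 u hu, hg.2 u hu]⟩
  zero_mem' := ⟨zero_mem _, fun u _ => map_zero _⟩
  smul_mem' := fun c f hf =>
    ⟨Submodule.smul_mem _ c hf.1, fun u hu => by rw [map_smul, hf.2 u hu]⟩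

theorem rowsSgn_mem_highestWeightFun {lam : Fin d → YoungDiagram}
    {b : Fin d → Fin m → Fin n × Fin n} (hb : ∀ i, IsBoxEnum (lam i).transpose (b i))
    (T : Fin d → Fin m → Fin n) :
    (fun X => (rowsSgn b T X : ℂ)) ∈ highestWeightFun n m lam := by
  refine ⟨fun X hX i j => ?_, fun u hu => ?_⟩
  · have h : boxSgn (b i) (T i) (X i) ≠ 0 :=
      Finset.prod_ne_zero_iff.1 (Int.cast_ne_zero.1 hX) i (Finset.mem_univ i)
    rw [(hb i).card_snd h, YoungDiagram.transpose_transpose]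
  · ext X
    rw [actFun_apply]
    simp only [rowsSgn, Int.cast_prod, ← Finset.prod_mul_distrib]
    rw [← Fintype.piFinset_univ, ← Finset.prod_univ_sum (fun _ => Finset.univ)
      (fun i (y : Fin m → Fin n) => (∏ k, u i (X i k) (y k)) * (boxSgn (b i) (T i) y : ℂ))]
    exact Finset.prod_congr rfl fun i _ => (hb i).sum_unitriangular (hu i) (T i) (X i)

theorem rowsSgnMap_mem_highestWeightFun {lam : Fin d → YoungDiagram}
    {b : Fin d → Fin m → Fin n × Fin n} (hb : ∀ i, IsBoxEnum (lam i).transpose (b i))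
    (c : (Fin d → Fin m → Fin n) → ℂ) : rowsSgnMap b c ∈ highestWeightFun n m lam := by
  have : rowsSgnMap b c = ∑ T, c T • fun X => (rowsSgn b T X : ℂ) := by
    ext X
    simp [rowsSgnMap_apply, mul_comm]
  rw [this]
  exact Submodule.sum_mem _ fun T _ => Submodule.smul_mem _ _ (rowsSgn_mem_highestWeightFun hb T)

theorem rowsSgnMap_single (b : Fin d → Fin m → Fin n × Fin n) (T : Fin d → Fin m → Fin n)
    (z : ℂ) : rowsSgnMap b (Pi.single T z) = z • fun X => (rowsSgn b T X : ℂ) := by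
  ext X
  simp [rowsSgnMap_apply, Pi.single_apply, mul_comm]

open Function in
-- Apply the invariance to the tuple that is `u` in row `i` and the identity in every other row.
theorem slice_unitriangular {lam : Fin d → YoungDiagram} {f : (Fin d → Fin m → Fin n) → ℂ}
    (hf : f ∈ highestWeightFun n m lam) (X : Fin d → Fin m → Fin n) (i : Fin d)
    {u : Matrix (Fin n) (Fin n) ℂ} (hu : IsUnitriangular u) (w : Fin m → Fin n) :
    ∑ y : Fin m → Fin n, (∏ k, u (w k) (y k)) * f (update X i y) = f (update X i w) := by
  classical
  have hU : ∀ j, IsUnitriangular (update (fun _ => (1 : Matrix (Fin n) (Fin n) ℂ)) i u j) := by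
    intro j
    by_cases hj : j = i
    · subst hj; simpa using hu
    · rw [update_of_ne hj]
      exact ⟨fun _ => Matrix.one_apply_eq _, fun _ _ h => Matrix.one_apply_ne h.ne'⟩
  have h := congrFun (hf.2 _ hU) (update X i w)
  rw [actFun_apply] at h
  refine Eq.trans ?_ h
  have hinj : Set.InjOn (fun y => update X i y)
      ((Finset.univ : Finset (Fin m → Fin n)) : Set (Fin m → Fin n)) :=
    (update_injective X i).injOn
  rw [← Finset.sum_subset (Finset.subset_univ (Finset.univ.image fun y => update X i y)),
    Finset.sum_image hinj]
  · refine Finset.sum_congr rfl fun y _ => ?_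
    congr 1
    rw [Finset.prod_eq_single i]
    · simp
    · intro j _ hj
      simp [hj]
    · simp
  · intro Y _ hY
    by_contra hne
    have h1 := Finset.prod_ne_zero_iff.1 (left_ne_zero_of_mul hne)
    refine hY (Finset.mem_image.2 ⟨Y i, Finset.mem_univ _, ?_⟩)
    ext1 j
    by_cases hj : j = i
    · subst hj; simp
    · ext1 k
      have h2 := Finset.prod_ne_zero_iff.1 (h1 j (Finset.mem_univ j)) k (Finset.mem_univ k)
      rw [update_of_ne hj, update_of_ne hj] at h2
      rw [update_of_ne hj]
      by_contra h3
      exact h2 (Matrix.one_apply_ne h3)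

/-- Tables ordered lexicographically by rows, each row being ordered colexicographically. -/
def rowsKey (X : Fin d → Fin m → Fin n) : Lex (Fin d → Colex (Fin m → Fin n)) :=
  toLex fun i => toColex (X i)

open Function in
theorem isLattice_of_isMax {lam : Fin d → YoungDiagram} {f : (Fin d → Fin m → Fin n) → ℂ}
    (hf : f ∈ highestWeightFun n m lam) {X : Fin d → Fin m → Fin n} (hX : f X ≠ 0)
    (hmax : ∀ Y, f Y ≠ 0 → rowsKey Y ≤ rowsKey X) (i : Fin d) : IsLattice (X i) := by
  have hwt : ∀ w, f (update X i w) ≠ 0 → ∀ j : Fin n,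
      (Finset.univ.filter fun k => w k = j).card = (lam i).rowLen j := fun w hw j => by
    simpa using hf.1 _ hw i j
  refine isLattice_of_raise_eq_zero (h := fun w => f (update X i w))
    (wt := fun j => (lam i).rowLen j) hwt
    (raise_eq_zero_of_unitriangular hwt fun u hu w => slice_unitriangular hf X i hu w) ?_ ?_
  · simpa using hX
  · intro y hy
    have h := hmax _ hy
    have e : rowsKey (update X i y) =
        toLex (update (fun i => toColex (X i)) i (toColex y)) :=
      congrArg toLex (funext fun j => apply_update (fun _ => toColex) X i y j)
    rw [e] at h
    exact Pi.toLex_update_le_self_iff.1 h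

theorem rowsKey_injective : Function.Injective (rowsKey : (Fin d → Fin m → Fin n) → _) :=
  fun _ _ h => funext fun i => toColex.injective (congrFun (toLex.injective h) i)

/-- Elimination of leading terms: the leading table has lattice rows, so choosing a suitable `t` in
each row gives a kernel function with the same leading table. Subtracting a multiple leaves a
highest weight function that is zero or has a smaller leading table. -/
theorem mem_range_rowsSgnMap {lam : Fin d → YoungDiagram}
    {b : Fin d → Fin m → Fin n × Fin n} (hb : ∀ i, IsBoxEnum (lam i).transpose (b i))
    {f : (Fin d → Fin m → Fin n) → ℂ} (hf : f ∈ highestWeightFun n m lam) :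
    f ∈ LinearMap.range (rowsSgnMap b) := by
  classical
  have hwf : WellFounded fun X Y : Fin d → Fin m → Fin n => rowsKey X < rowsKey Y :=
    haveI : IsTrans (Fin d → Fin m → Fin n) fun X Y => rowsKey X < rowsKey Y :=
      ⟨fun _ _ _ => lt_trans⟩
    haveI : Std.Irrefl fun X Y : Fin d → Fin m → Fin n => rowsKey X < rowsKey Y :=
      ⟨fun _ => lt_irrefl _⟩
    Finite.wellFounded_of_trans_of_irrefl _
  have exists_max : ∀ f : (Fin d → Fin m → Fin n) → ℂ, f ≠ 0 →
      ∃ X, f X ≠ 0 ∧ ∀ Y, f Y ≠ 0 → rowsKey Y ≤ rowsKey X := by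
    intro f hf
    obtain ⟨Z, hZ⟩ := Function.ne_iff.1 hf
    obtain ⟨X, hX, hmax⟩ := Finset.exists_max_image (Finset.univ.filter fun X => f X ≠ 0) rowsKey
      ⟨Z, by simpa using hZ⟩
    exact ⟨X, by simpa using hX, fun Y hY => hmax Y (by simpa using hY)⟩
  have key : ∀ X, ∀ f ∈ highestWeightFun n m lam, f X ≠ 0 →
      (∀ Y, f Y ≠ 0 → rowsKey Y ≤ rowsKey X) → f ∈ LinearMap.range (rowsSgnMap b) := by
    intro X
    induction X using hwf.induction with
    | _ X ih =>
    intro f hf hX hmax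
    have hlead : ∀ i, ∃ t, boxSgn (b i) t (X i) ≠ 0 ∧
        ∀ y, boxSgn (b i) t y ≠ 0 → toColex y ≤ toColex (X i) := fun i =>
      (hb i).exists_leading (isLattice_of_isMax hf hX hmax i) fun j => by
        rw [YoungDiagram.transpose_transpose]; exact hf.1 X hX i j
    choose T hT hTmax using hlead
    have hTX : (rowsSgn b T X : ℂ) ≠ 0 :=
      Int.cast_ne_zero.2 (Finset.prod_ne_zero_iff.2 fun i _ => hT i)
    set g : (Fin d → Fin m → Fin n) → ℂ := rowsSgnMap b (Pi.single T (f X / rowsSgn b T X)) with hg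
    have hgX : g X = f X := by
      rw [hg, rowsSgnMap_single, Pi.smul_apply, smul_eq_mul, div_mul_cancel₀ _ hTX]
    have hgmax : ∀ Y, g Y ≠ 0 → rowsKey Y ≤ rowsKey X := by
      intro Y hY
      rw [hg, rowsSgnMap_single, Pi.smul_apply, smul_eq_mul] at hY
      have h1 := Finset.prod_ne_zero_iff.1 (Int.cast_ne_zero.1 (right_ne_zero_of_mul hY))
      exact Pi.toLex_monotone fun i => hTmax i _ (h1 i (Finset.mem_univ i))
    have hgr : g ∈ LinearMap.range (rowsSgnMap b) := ⟨_, rfl⟩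
    suffices h : f - g ∈ LinearMap.range (rowsSgnMap b) by
      simpa using add_mem h hgr
    by_cases h0 : f - g = 0
    · rw [h0]; exact zero_mem _
    · obtain ⟨Z, hZ, hZmax⟩ := exists_max _ h0
      refine ih Z (lt_of_le_of_ne ?_ ?_) _
        (sub_mem hf (rowsSgnMap_mem_highestWeightFun hb _)) hZ hZmax
      · by_cases hfZ : f Z = 0
        · exact hgmax Z fun h => hZ (by simp [hfZ, h])
        · exact hmax Z hfZ
      · intro h
        rw [rowsKey_injective h] at hZ
        exact hZ (by simp [hgX])
  by_cases h0 : f = 0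
  · rw [h0]; exact zero_mem _
  · obtain ⟨X, hX, hmax⟩ := exists_max f h0
    exact key X f hf hX hmax

/-- The spanning result for the conjugate shapes writes `v` as the transposed kernel applied to some
`c`, up to sign. Moving the kernel to the other side of the pairing of `v` with `r v` yields `∑ r
‖v‖² = 0`. -/
theorem eq_zero_of_rowsSgnMap_mul_eq_zero {lam : Fin d → YoungDiagram}
    {b b' : Fin d → Fin m → Fin n × Fin n} (hb : ∀ i, IsBoxEnum (lam i).transpose (b i))
    (hb' : ∀ i, IsBoxEnum (lam i) (b' i)) {r : (Fin d → Fin m → Fin n) → ℝ} (hr : ∀ T, 0 < r T)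
    {v : (Fin d → Fin m → Fin n) → ℂ} (hv : v ∈ highestWeightFun n m (conjTuple lam))
    (h0 : rowsSgnMap b (fun T => (r T : ℂ) * v T) = 0) : v = 0 := by
  have hb'' : ∀ i, IsBoxEnum (conjTuple lam i).transpose (b' i) := fun i => by
    rw [conjTuple, YoungDiagram.transpose_transpose]; exact hb' i
  obtain ⟨c, hc⟩ := mem_range_rowsSgnMap hb'' hv
  have hε : ∀ i, ∃ ε : ℤˣ, ∀ t x : Fin m → Fin n,
      boxSgn (b' i) x t = ε * boxSgn (b i) t x := fun i =>
    (hb i).exists_transpose (by rw [YoungDiagram.transpose_transpose]; exact hb' i)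
  choose ε hε using hε
  have hsgn : ∀ T X, rowsSgn b' X T = (∏ i, (ε i : ℤ)) * rowsSgn b T X := fun T X => by
    rw [rowsSgn, rowsSgn, ← Finset.prod_mul_distrib]
    exact Finset.prod_congr rfl fun i _ => hε i _ _
  have hsum : ((∑ T, r T * ‖v T‖ ^ 2 : ℝ) : ℂ) = 0 := by
    calc ((∑ T, r T * ‖v T‖ ^ 2 : ℝ) : ℂ)
        = ∑ T, star (v T) * ((r T : ℂ) * v T) := by
          push_cast
          refine Finset.sum_congr rfl fun T _ => ?_
          rw [← Complex.mul_conj', Complex.star_def]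
          ring
      _ = ∑ T, ∑ X, star (c X) * ((∏ i, (ε i : ℤ) : ℤ) : ℂ) *
            ((rowsSgn b T X : ℂ) * ((r T : ℂ) * v T)) := by
          refine Finset.sum_congr rfl fun T _ => ?_
          have hvT : star (v T) = ∑ X, star ((rowsSgn b' X T : ℂ) * c X) := by
            rw [← star_sum, ← rowsSgnMap_apply, hc]
          rw [hvT, Finset.sum_mul]
          refine Finset.sum_congr rfl fun X _ => ?_
          rw [hsgn, star_mul', Int.cast_mul, star_mul']
          simp only [Complex.star_def, map_intCast]
          ring
      _ = ∑ X, star (c X) * ((∏ i, (ε i : ℤ) : ℤ) : ℂ) *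
            rowsSgnMap b (fun T => (r T : ℂ) * v T) X := by
          rw [Finset.sum_comm]
          refine Finset.sum_congr rfl fun X _ => ?_
          rw [rowsSgnMap_apply, Finset.mul_sum]
      _ = 0 := by simp [h0]
  rw [Complex.ofReal_eq_zero, Finset.sum_eq_zero_iff_of_nonneg fun T _ =>
    mul_nonneg (hr T).le (by positivity)] at hsum
  ext T
  have := hsum T (Finset.mem_univ T)
  simpa [(hr T).ne'] using this

end

/-! ### Coordinates, permutation operators and weight spaces -/

section
variable {n d m : ℕ}

/-- The standard basis of `⨂^m (ℂ^n)^{⊗ d}`, indexed by tables. -/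
def tableBasis (n d m : ℕ) : Module.Basis (Table n d m) ℂ (TensorPow n d m) :=
  Basis.piTensorProduct fun _ => Basis.piTensorProduct fun _ => Pi.basisFun ℂ (Fin n)

theorem tableBasis_apply (T : Table n d m) :
    tableBasis n d m T = PiTensorProduct.tprod ℂ fun k => stdTensor (T k) := by
  simp [tableBasis, stdTensor, Pi.basisFun_apply]

/-- The coordinates of a tensor, indexed by tables given by rows. -/
def rowCoord (n d m : ℕ) : TensorPow n d m ≃ₗ[ℂ] ((Fin d → Fin m → Fin n) → ℂ) :=
  ((tableBasis n d m).reindex (Equiv.piComm fun _ _ => Fin n)).equivFun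

theorem rowCoord_apply (v : TensorPow n d m) (X : Fin d → Fin m → Fin n) :
    rowCoord n d m v X = (tableBasis n d m).repr v fun k i => X i k := by
  simp [rowCoord]
  rfl

theorem rowCoord_tableBasis (T : Table n d m) :
    rowCoord n d m (tableBasis n d m T) = Pi.single (fun i k => T k i) 1 := by
  ext X
  rw [rowCoord_apply, Module.Basis.repr_self, Finsupp.single_apply, Pi.single_apply]
  congr 1
  rw [eq_iff_iff]
  exact ⟨fun h => by rw [h], fun h => by rw [h]⟩

theorem rowCoord_act (g : Fin d → Matrix (Fin n) (Fin n) ℂ) (v : TensorPow n d m) :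
    rowCoord n d m (act m g v) = actFun m g (rowCoord n d m v) := by
  have : (rowCoord n d m).toLinearMap ∘ₗ act m g =
      actFun m g ∘ₗ (rowCoord n d m).toLinearMap := by
    refine (tableBasis n d m).ext fun T => ?_
    ext X
    simp only [LinearMap.comp_apply, LinearEquiv.coe_coe]
    rw [rowCoord_tableBasis, actFun_apply, tableBasis_apply, rowCoord_apply, act,
      PiTensorProduct.map_tprod, tableBasis, Basis.piTensorProduct_repr_tprod_apply]
    simp only [stdTensor, PiTensorProduct.map_tprod, Basis.piTensorProduct_repr_tprod_apply]
    rw [Finset.prod_comm]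
    simp [Pi.single_apply]
  exact LinearMap.congr_fun this v

/-- The action of a permutation on the `m` tensor factors. -/
def permTensor (n d : ℕ) {m : ℕ} (w : Equiv.Perm (Fin m)) :
    TensorPow n d m →ₗ[ℂ] TensorPow n d m :=
  (PiTensorProduct.reindex ℂ (fun _ : Fin m => TensorV n d) w.symm).toLinearMap

theorem permTensor_tableBasis (w : Equiv.Perm (Fin m)) (T : Table n d m) :
    permTensor n d w (tableBasis n d m T) = tableBasis n d m (T ∘ w) := by
  rw [tableBasis_apply, tableBasis_apply]
  exact PiTensorProduct.reindex_tprod _ _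

theorem permTensor_permTensor (w w' : Equiv.Perm (Fin m)) (v : TensorPow n d m) :
    permTensor n d w (permTensor n d w' v) = permTensor n d (w' * w) v := by
  have : permTensor n d w ∘ₗ permTensor n d w' = permTensor n d (w' * w) := by
    refine (tableBasis n d m).ext fun T => ?_
    rw [LinearMap.comp_apply, permTensor_tableBasis, permTensor_tableBasis, permTensor_tableBasis]
    rfl
  exact LinearMap.congr_fun this v

theorem rowCoord_permTensor (w : Equiv.Perm (Fin m)) (v : TensorPow n d m)
    (X : Fin d → Fin m → Fin n) :
    rowCoord n d m (permTensor n d w v) X = rowCoord n d m v fun i => X i ∘ w.symm := by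
  have : (rowCoord n d m).toLinearMap ∘ₗ permTensor n d w =
      (LinearMap.funLeft ℂ ℂ fun (X : Fin d → Fin m → Fin n) i => X i ∘ w.symm) ∘ₗ
        (rowCoord n d m).toLinearMap := by
    refine (tableBasis n d m).ext fun T => ?_
    ext X
    simp only [LinearMap.comp_apply, LinearEquiv.coe_coe, LinearMap.funLeft_apply]
    rw [permTensor_tableBasis, rowCoord_tableBasis, rowCoord_tableBasis, Pi.single_apply,
      Pi.single_apply]
    congr 1
    rw [eq_iff_iff]
    constructor
    · rintro rfl
      ext i k
      simp
    · intro h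
      ext i k
      have := congrFun (congrFun h i) (w k)
      simp only [Function.comp_apply, Equiv.symm_apply_apply] at this
      rw [this]
      rfl
  exact congrFun (LinearMap.congr_fun this v) X

/-- The operator `∑_w χ(w) w` on `⨂^m V` for a linear character `χ` of the symmetric group. -/
def permOp (n d : ℕ) {m : ℕ} (χ : Equiv.Perm (Fin m) →* ℤˣ) :
    TensorPow n d m →ₗ[ℂ] TensorPow n d m :=
  ∑ w : Equiv.Perm (Fin m), ((χ w : ℤ) : ℂ) • permTensor n d w

theorem permOp_apply (χ : Equiv.Perm (Fin m) →* ℤˣ) (v : TensorPow n d m) :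
    permOp n d χ v = ∑ w : Equiv.Perm (Fin m), ((χ w : ℤ) : ℂ) • permTensor n d w v := by
  simp [permOp]

theorem symOp_eq_permOp : symOp n d m = permOp n d 1 := by
  simp [symOp, permOp, permTensor]

theorem altOp_eq_permOp : altOp n d m = permOp n d Equiv.Perm.sign := rfl

theorem veeVec_eq (X : Table n d m) : veeVec X = permOp n d 1 (tableBasis n d m X) := by
  rw [veeVec, symOp_eq_permOp, tableBasis_apply]

theorem wedgeVec_eq (X : Table n d m) :
    wedgeVec X = permOp n d Equiv.Perm.sign (tableBasis n d m X) := by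
  rw [wedgeVec, altOp_eq_permOp, tableBasis_apply]

theorem int_units_mul_self_cast (u : ℤˣ) : (((u : ℤˣ) : ℤ) : ℂ) * ((u : ℤ) : ℂ) = 1 := by
  rw [← Int.cast_mul, ← Units.val_mul, Int.units_mul_self]
  simp

theorem permOp_permTensor (χ : Equiv.Perm (Fin m) →* ℤˣ) (w : Equiv.Perm (Fin m))
    (v : TensorPow n d m) :
    permOp n d χ (permTensor n d w v) = ((χ w : ℤ) : ℂ) • permOp n d χ v := by
  simp only [permOp_apply, permTensor_permTensor, Finset.smul_sum, smul_smul]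
  rw [← Equiv.sum_comp (Equiv.mulLeft w)
    (fun w' => (((χ w : ℤ) : ℂ) * ((χ w' : ℤ) : ℂ)) • permTensor n d w' v)]
  refine Finset.sum_congr rfl fun w' _ => ?_
  simp only [Equiv.coe_mulLeft, map_mul, Units.val_mul, Int.cast_mul]
  rw [← mul_assoc, int_units_mul_self_cast, one_mul]

theorem permOp_permOp (χ : Equiv.Perm (Fin m) →* ℤˣ) (v : TensorPow n d m) :
    permOp n d χ (permOp n d χ v) = (m.factorial : ℂ) • permOp n d χ v := by
  conv_lhs => rw [permOp_apply χ v, map_sum]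
  simp only [map_smul, permOp_permTensor, smul_smul, int_units_mul_self_cast, one_smul]
  rw [Finset.sum_const, Finset.card_univ, Fintype.card_perm, Fintype.card_fin,
    ← Nat.cast_smul_eq_nsmul ℂ]

theorem permOp_of_mem_range {χ : Equiv.Perm (Fin m) →* ℤˣ} {v : TensorPow n d m}
    (hv : v ∈ LinearMap.range (permOp n d χ)) :
    permOp n d χ v = (m.factorial : ℂ) • v := by
  obtain ⟨u, rfl⟩ := hv
  exact permOp_permOp χ u

theorem permOp_tableBasis_comp (χ : Equiv.Perm (Fin m) →* ℤˣ) (w : Equiv.Perm (Fin m))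
    (T : Table n d m) : permOp n d χ (tableBasis n d m (T ∘ w)) =
      ((χ w : ℤ) : ℂ) • permOp n d χ (tableBasis n d m T) := by
  rw [← permTensor_tableBasis, permOp_permTensor]

theorem permOp_sign_tableBasis_eq_zero {T : Table n d m} (hT : ¬ Function.Injective T) :
    permOp n d Equiv.Perm.sign (tableBasis n d m T) = 0 := by
  obtain ⟨k, l, hkl, hne⟩ := Function.not_injective_iff.1 hT
  have hTs : T ∘ Equiv.swap k l = T := by
    ext1 j
    by_cases h1 : j = k
    · subst h1; simp [hkl]
    · by_cases h2 : j = l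
      · subst h2; simp [hkl]
      · simp [Equiv.swap_apply_of_ne_of_ne h1 h2]
  have h := permOp_tableBasis_comp Equiv.Perm.sign (Equiv.swap k l) T
  rw [hTs, Equiv.Perm.sign_swap hne, Units.val_neg, Units.val_one, Int.cast_neg, Int.cast_one] at h
  apply (rowCoord n d m).injective
  ext X
  have hX := congrFun (congrArg (rowCoord n d m) h) X
  rw [map_smul, Pi.smul_apply, smul_eq_mul] at hX
  rw [map_zero, Pi.zero_apply]
  linear_combination hX / 2

theorem mem_weightFun_permTensor {lam : Fin d → YoungDiagram} {v : TensorPow n d m}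
    (hv : rowCoord n d m v ∈ weightFun n m lam) (w : Equiv.Perm (Fin m)) :
    rowCoord n d m (permTensor n d w v) ∈ weightFun n m lam := by
  intro X hX i j
  rw [rowCoord_permTensor] at hX
  rw [← hv _ hX i j]
  refine Finset.card_bij (fun k _ => w k) ?_ ?_ ?_
  · intro k hk
    simpa using hk
  · intro k _ l _ h
    exact w.injective h
  · intro k hk
    exact ⟨w.symm k, by simpa using hk, by simp⟩

theorem mem_weightFun_permOp {lam : Fin d → YoungDiagram} {v : TensorPow n d m}
    (hv : rowCoord n d m v ∈ weightFun n m lam) (χ : Equiv.Perm (Fin m) →* ℤˣ) :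
    rowCoord n d m (permOp n d χ v) ∈ weightFun n m lam := by
  rw [permOp_apply, map_sum]
  refine Submodule.sum_mem _ fun w _ => ?_
  rw [map_smul]
  exact Submodule.smul_mem _ _ (mem_weightFun_permTensor hv w)

theorem actFun_diagonal (t : Fin d → Fin n → ℂ) (f : (Fin d → Fin m → Fin n) → ℂ)
    (X : Fin d → Fin m → Fin n) :
    actFun m (fun i => Matrix.diagonal (t i)) f X =
      (∏ i, ∏ j, t i j ^ (Finset.univ.filter fun k => X i k = j).card) * f X := by
  rw [actFun_apply, Finset.sum_eq_single X]
  · congr 1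
    refine Finset.prod_congr rfl fun i _ => ?_
    simp only [Matrix.diagonal_apply_eq]
    rw [← Finset.prod_fiberwise Finset.univ (X i)]
    refine Finset.prod_congr rfl fun j _ => ?_
    rw [Finset.prod_congr rfl fun k hk => by rw [(Finset.mem_filter.1 hk).2], Finset.prod_const]
  · intro Y _ hY
    obtain ⟨i, hi⟩ := Function.ne_iff.1 hY
    obtain ⟨k, hk⟩ := Function.ne_iff.1 hi
    rw [Finset.prod_eq_zero (Finset.mem_univ i), zero_mul]
    exact Finset.prod_eq_zero (Finset.mem_univ k) (Matrix.diagonal_apply_ne _ (Ne.symm hk))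
  · simp

theorem mem_weightSpace_iff {W : Submodule ℂ (TensorPow n d m)} {lam : Fin d → YoungDiagram}
    {v : TensorPow n d m} :
    v ∈ weightSpace W lam ↔ v ∈ W ∧ rowCoord n d m v ∈ weightFun n m lam := by
  refine and_congr_right fun _ => ⟨fun h X hX i j => ?_, fun h t => ?_⟩
  -- The torus element with entry `2` in place `(i, j)` and `1` elsewhere compares `2 ^ count` with
  -- `2 ^ rowLen`.
  · have h1 := congrFun (congrArg (rowCoord n d m)
      (h fun i' j' => if i' = i ∧ j' = j then Units.mk0 2 two_ne_zero else 1)) X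
    rw [rowCoord_act, map_smul, Pi.smul_apply, smul_eq_mul,
      actFun_diagonal (fun i' j' => (((if i' = i ∧ j' = j then Units.mk0 2 two_ne_zero else 1 : ℂˣ)
        : ℂˣ) : ℂ))] at h1
    have h2 := mul_right_cancel₀ hX h1
    have e : ∀ c : Fin d → Fin n → ℕ, ∏ i', ∏ j',
        (((if i' = i ∧ j' = j then Units.mk0 2 two_ne_zero else 1 : ℂˣ) : ℂˣ) : ℂ) ^ c i' j' =
        2 ^ c i j := by
      intro c
      rw [Finset.prod_eq_single i, Finset.prod_eq_single j]
      · simp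
      · intro j' _ hj'; simp [hj']
      · simp
      · intro i' _ hi'; simp [hi']
      · simp
    rw [e fun i' j' => (Finset.univ.filter fun k => X i' k = j').card,
      e fun i' j' => (lam i').rowLen j'] at h2
    exact Nat.pow_right_injective le_rfl (by exact_mod_cast h2)
  · apply (rowCoord n d m).injective
    ext X
    rw [rowCoord_act, map_smul, Pi.smul_apply, smul_eq_mul,
      actFun_diagonal (fun i j => (t i j : ℂ))]
    by_cases hX : rowCoord n d m v X = 0
    · simp [hX]
    · simp only [h X hX]

theorem mem_highestWeightSpace_iff {W : Submodule ℂ (TensorPow n d m)}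
    {lam : Fin d → YoungDiagram} {v : TensorPow n d m} :
    v ∈ highestWeightSpace W lam ↔ v ∈ W ∧ rowCoord n d m v ∈ highestWeightFun n m lam := by
  have : (∀ u : Fin d → Matrix (Fin n) (Fin n) ℂ,
      (∀ i, IsUnitriangular (u i)) → act m u v = v) ↔
      ∀ u : Fin d → Matrix (Fin n) (Fin n) ℂ, (∀ i, IsUnitriangular (u i)) →
        actFun m u (rowCoord n d m v) = rowCoord n d m v := by
    refine forall_congr' fun u => imp_congr_right fun _ => ?_
    rw [← rowCoord_act, (rowCoord n d m).injective.eq_iff]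
  change v ∈ weightSpace W lam ∧ _ ↔ v ∈ W ∧ rowCoord n d m v ∈ weightFun n m lam ∧ _
  rw [mem_weightSpace_iff, this, and_assoc]

end

/-! ### Linear algebra over additive monoids, with negation supplied by the scalar `-1` -/

section
variable {M N : Type*} [AddCommMonoid M] [Module ℂ M] [AddCommMonoid N] [Module ℂ N]

theorem injective_of_forall_eq_zero {f : M →ₗ[ℂ] N} (h : ∀ x, f x = 0 → x = 0) :
    Function.Injective f := by
  let _ := Module.addCommMonoidToAddCommGroup ℂ (M := M)
  let _ := Module.addCommMonoidToAddCommGroup ℂ (M := N)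
  exact (injective_iff_map_eq_zero f).2 h

theorem module_finite_submodule [Module.Finite ℂ M] (P : Submodule ℂ M) : Module.Finite ℂ P := by
  let _ := Module.addCommMonoidToAddCommGroup ℂ (M := M)
  infer_instance

theorem bijective_of_injective_of_injective [Module.Finite ℂ M] [Module.Finite ℂ N]
    {f : M →ₗ[ℂ] N} {g : N →ₗ[ℂ] M} (hf : Function.Injective f) (hg : Function.Injective g) :
    Function.Bijective f := by
  let _ := Module.addCommMonoidToAddCommGroup ℂ (M := M)
  let _ := Module.addCommMonoidToAddCommGroup ℂ (M := N)
  exact ⟨hf, (LinearMap.injective_iff_surjective_of_finrank_eq_finrank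
    (le_antisymm (LinearMap.finrank_le_finrank_of_injective hf)
      (LinearMap.finrank_le_finrank_of_injective hg))).1 hf⟩

end

/-! ### The duality operator -/

section
variable {n d m : ℕ}

theorem stabSize_pos (T : Table n d m) : 0 < stabSize T :=
  haveI : Nonempty {p : Equiv.Perm (Fin m) // T ∘ p = T} := ⟨⟨1, rfl⟩⟩
  Nat.card_pos

theorem stabSize_comp (T : Table n d m) (w : Equiv.Perm (Fin m)) :
    stabSize (T ∘ w) = stabSize T := by
  refine Nat.card_congr ((Equiv.subtypeEquiv (MulAut.conj w).toEquiv fun p => ?_))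
  constructor
  · intro h
    ext1 k
    have := congrFun h (w.symm k)
    simpa using this
  · intro h
    ext1 k
    have := congrFun h (w k)
    simpa using this

/-- The reciprocals of the sizes of the stabilizers of tables. -/
def stabInv (n d m : ℕ) (T : Fin d → Fin m → Fin n) : ℝ := (stabSize fun k i => T i k : ℝ)⁻¹

theorem stabInv_pos (T : Fin d → Fin m → Fin n) : 0 < stabInv n d m T :=
  inv_pos.2 (Nat.cast_pos.2 (stabSize_pos _))

theorem stabInv_comp (T : Fin d → Fin m → Fin n) (w : Equiv.Perm (Fin m)) :
    stabInv n d m (fun i => T i ∘ w) = stabInv n d m T := by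
  have h : stabSize (fun k i => (T i ∘ w) k) = stabSize fun k i => T i k :=
    stabSize_comp (fun k i => T i k) w
  rw [stabInv, stabInv, h]

/-- The map `e_T ↦ ‖T‖⁻¹ ∑_X ± e_X` on `⨂^m V` underlying all the duality maps. -/
def dualityMap (b : Fin d → Fin m → Fin n × Fin n) :
    TensorPow n d m →ₗ[ℂ] TensorPow n d m :=
  (rowCoord n d m).symm.toLinearMap ∘ₗ rowsSgnMap b ∘ₗ
    LinearMap.mulLeft ℂ (fun T => (stabInv n d m T : ℂ)) ∘ₗ (rowCoord n d m).toLinearMap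

theorem rowCoord_dualityMap (b : Fin d → Fin m → Fin n × Fin n) (v : TensorPow n d m) :
    rowCoord n d m (dualityMap b v) =
      rowsSgnMap b fun T => (stabInv n d m T : ℂ) * rowCoord n d m v T := by
  simp only [dualityMap, LinearMap.comp_apply, LinearEquiv.coe_coe, LinearEquiv.apply_symm_apply]
  rfl

theorem rowsSgn_comp (b : Fin d → Fin m → Fin n × Fin n) (T X : Fin d → Fin m → Fin n)
    (w : Equiv.Perm (Fin m)) :
    rowsSgn b (fun i => T i ∘ w) (fun i => X i ∘ w) =
      (Equiv.Perm.sign w : ℤ) ^ d * rowsSgn b T X := by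
  simp only [rowsSgn, boxSgn_comp_perm, Finset.prod_mul_distrib, Finset.prod_const,
    Finset.card_univ, Fintype.card_fin]

/-- Each of the `d` rows contributes one factor `sgn(w)`, and the stabilizer sizes are constant on
orbits. This is the source of the dependence on the parity of `d`. -/
theorem dualityMap_permTensor (b : Fin d → Fin m → Fin n × Fin n) (w : Equiv.Perm (Fin m))
    (v : TensorPow n d m) :
    dualityMap b (permTensor n d w v) =
      (((Equiv.Perm.sign w : ℤ) ^ d : ℤ) : ℂ) • permTensor n d w (dualityMap b v) := by
  apply (rowCoord n d m).injective
  ext X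
  rw [rowCoord_dualityMap, rowsSgnMap_apply, map_smul, Pi.smul_apply, smul_eq_mul,
    rowCoord_permTensor, rowCoord_dualityMap, rowsSgnMap_apply, Finset.mul_sum]
  rw [← Equiv.sum_comp (Equiv.piCongrRight fun _ : Fin d =>
    (Equiv.arrowCongr w.symm (Equiv.refl (Fin n))))]
  refine Finset.sum_congr rfl fun T _ => ?_
  have hT : (Equiv.piCongrRight fun _ : Fin d =>
      (Equiv.arrowCongr w.symm (Equiv.refl (Fin n)))) T = fun i => T i ∘ w := rfl
  have hX : X = fun i => (X i ∘ w.symm) ∘ w := by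
    ext i k; simp
  have hT' : (fun i => (T i ∘ w) ∘ w.symm) = T := by
    ext i k; simp
  rw [hT, stabInv_comp, rowCoord_permTensor, hT']
  conv_lhs => rw [hX, rowsSgn_comp]
  push_cast
  ring

theorem dualityMap_permOp (b : Fin d → Fin m → Fin n × Fin n)
    {χ χ' : Equiv.Perm (Fin m) →* ℤˣ}
    (hχ : ∀ w, χ' w = χ w * Equiv.Perm.sign w ^ d) (v : TensorPow n d m) :
    dualityMap b (permOp n d χ v) = permOp n d χ' (dualityMap b v) := by
  simp only [permOp_apply, map_sum, map_smul, dualityMap_permTensor, smul_smul, hχ]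
  refine Finset.sum_congr rfl fun w _ => ?_
  push_cast
  rfl

theorem dualityMap_tableBasis (b : Fin d → Fin m → Fin n × Fin n) (T : Table n d m) :
    dualityMap b (tableBasis n d m T) = (stabSize T : ℂ)⁻¹ •
      ∑ X : Table n d m, (rowsSgn b (fun i k => T k i) (fun i k => X k i) : ℂ) •
        tableBasis n d m X := by
  apply (rowCoord n d m).injective
  ext X
  rw [rowCoord_dualityMap, rowCoord_tableBasis, rowsSgnMap_apply, map_smul, map_sum]
  simp only [map_smul, rowCoord_tableBasis, Pi.smul_apply, Finset.sum_apply, smul_eq_mul]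
  rw [Finset.sum_eq_single fun i k => T k i, Finset.sum_eq_single fun k i => X i k]
  · simp [stabInv, mul_comm]
  · intro Y _ hY
    rw [Pi.single_eq_of_ne, mul_zero]
    rintro rfl
    exact hY rfl
  · simp
  · intro Y _ hY
    simp [hY]
  · simp

theorem invSign_mul_tableSgn {lam : Fin d → YoungDiagram} {b : Fin d → Fin m → Fin n × Fin n}
    (hb : ∀ i, IsBoxEnum (lam i).transpose (b i)) {T : Table n d m}
    (hT : T ∈ tablesN n m (conjTuple lam)) (X : Table n d m) :
    invSign T * tableSgn T X = rowsSgn b (fun i k => T k i) (fun i k => X k i) := by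
  rw [invSign, tableSgn, ← Finset.prod_mul_distrib]
  exact Finset.prod_congr rfl fun i _ => (hb i).neg_one_pow_invNum_mul_wordSgn (hT i) _

theorem mem_tablesN_of_rowsSgn_ne_zero {lam : Fin d → YoungDiagram}
    {b : Fin d → Fin m → Fin n × Fin n} (hb : ∀ i, IsBoxEnum (lam i).transpose (b i))
    {T X : Table n d m} (h : rowsSgn b (fun i k => T k i) (fun i k => X k i) ≠ 0) :
    X ∈ tablesN n m lam := fun i j => by
  have h1 := Finset.prod_ne_zero_iff.1 h i (Finset.mem_univ i)
  rw [(hb i).card_snd h1, YoungDiagram.transpose_transpose]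

theorem deltaVec_eq {lam : Fin d → YoungDiagram} {b : Fin d → Fin m → Fin n × Fin n}
    (hb : ∀ i, IsBoxEnum (lam i).transpose (b i)) {T : Table n d m}
    (hT : T ∈ tablesN n m (conjTuple lam)) :
    deltaVec lam T = permOp n d 1 (dualityMap b (tableBasis n d m T)) := by
  classical
  rw [dualityMap_tableBasis, map_smul, map_sum, deltaVec, div_eq_inv_mul, mul_smul,
    Finset.smul_sum]
  congr 1
  rw [← Finset.sum_subset (Finset.subset_univ
    (Finset.univ.filter fun X : Table n d m => X ∈ tablesN n m lam))]
  · refine Finset.sum_congr (by congr) fun X _ => ?_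
    rw [smul_smul, map_smul, veeVec_eq, ← invSign_mul_tableSgn hb hT, Int.cast_mul]
  · intro X _ hX
    have : rowsSgn b (fun i k => T k i) (fun i k => X k i) = 0 := by
      by_contra h
      exact hX (by simpa using mem_tablesN_of_rowsSgn_ne_zero hb h)
    simp [this]

/-- Tables outside `B(lam)` drop out for two reasons: a wrong weight kills the kernel, and a
repeated column kills the alternating tensor. -/
theorem nablaVec_eq {lam : Fin d → YoungDiagram} {b : Fin d → Fin m → Fin n × Fin n}
    (hb : ∀ i, IsBoxEnum (lam i).transpose (b i)) {T : Table n d m}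
    (hT : T ∈ tablesN n m (conjTuple lam)) :
    nablaVec lam T = permOp n d Equiv.Perm.sign (dualityMap b (tableBasis n d m T)) := by
  classical
  rw [dualityMap_tableBasis, map_smul, map_sum, nablaVec, div_eq_inv_mul, mul_smul,
    Finset.smul_sum]
  congr 1
  rw [← Finset.sum_subset (Finset.subset_univ
    (Finset.univ.filter fun X : Table n d m => X ∈ tables01 n m lam))]
  · refine Finset.sum_congr (by congr) fun X _ => ?_
    rw [smul_smul, map_smul, wedgeVec_eq, ← invSign_mul_tableSgn hb hT, Int.cast_mul]
  · intro X _ hX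
    rw [map_smul]
    by_cases hinj : Function.Injective X
    · have : rowsSgn b (fun i k => T k i) (fun i k => X k i) = 0 := by
        by_contra h
        exact hX (by simpa using ⟨mem_tablesN_of_rowsSgn_ne_zero hb h, hinj⟩)
      simp [this]
    · rw [permOp_sign_tableBasis_eq_zero hinj, smul_zero]

theorem dualityMap_mem_highestWeightSpace {lam : Fin d → YoungDiagram}
    {b : Fin d → Fin m → Fin n × Fin n} (hb : ∀ i, IsBoxEnum (lam i).transpose (b i))
    {χ χ' : Equiv.Perm (Fin m) →* ℤˣ} (hχ : ∀ w, χ' w = χ w * Equiv.Perm.sign w ^ d)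
    {v : TensorPow n d m} (hv : v ∈ LinearMap.range (permOp n d χ)) :
    dualityMap b v ∈ highestWeightSpace (LinearMap.range (permOp n d χ')) lam := by
  rw [mem_highestWeightSpace_iff, rowCoord_dualityMap]
  refine ⟨?_, rowsSgnMap_mem_highestWeightFun hb _⟩
  obtain ⟨u, rfl⟩ := hv
  exact ⟨_, (dualityMap_permOp b hχ u).symm⟩

/-- A preimage among all tensors exists by the spanning result. Projecting it with `permOp n d χ /
m!` keeps it a preimage, because `dualityMap b` intertwines this projection with the one for `χ'`,
which fixes `v`. -/
theorem exists_dualityMap_eq {lam : Fin d → YoungDiagram}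
    {b : Fin d → Fin m → Fin n × Fin n} (hb : ∀ i, IsBoxEnum (lam i).transpose (b i))
    {χ χ' : Equiv.Perm (Fin m) →* ℤˣ} (hχ : ∀ w, χ' w = χ w * Equiv.Perm.sign w ^ d)
    {v : TensorPow n d m}
    (hv : v ∈ highestWeightSpace (LinearMap.range (permOp n d χ')) lam) :
    ∃ u ∈ weightSpace (LinearMap.range (permOp n d χ)) (conjTuple lam), dualityMap b u = v := by
  classical
  rw [mem_highestWeightSpace_iff] at hv
  obtain ⟨c, hc⟩ := mem_range_rowsSgnMap hb hv.2
  -- Cutting `c` down to weight `λ'` changes nothing, since the kernel vanishes on all other `T`;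
  -- the inverse factor cancels the stabilizer weights built into `dualityMap`.
  set c' : (Fin d → Fin m → Fin n) → ℂ := fun T =>
    if ∀ i (j : Fin n), (Finset.univ.filter fun k => T i k = j).card = (conjTuple lam i).rowLen j
    then (stabInv n d m T : ℂ)⁻¹ * c T else 0 with hc'
  set u := (rowCoord n d m).symm c' with hu
  have hu1 : dualityMap b u = v := by
    apply (rowCoord n d m).injective
    rw [rowCoord_dualityMap, ← hc, hu, LinearEquiv.apply_symm_apply]
    ext X
    rw [rowsSgnMap_apply, rowsSgnMap_apply]
    refine Finset.sum_congr rfl fun T _ => ?_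
    by_cases h : rowsSgn b T X = 0
    · simp [h]
    · have hT : ∀ i (j : Fin n), (Finset.univ.filter fun k => T i k = j).card =
          (conjTuple lam i).rowLen j := fun i j =>
        (hb i).card_fst (Finset.prod_ne_zero_iff.1 h i (Finset.mem_univ i)) j
      have h0 : (stabInv n d m T : ℂ) ≠ 0 := Complex.ofReal_ne_zero.2 (stabInv_pos T).ne'
      simp only [hc']
      rw [if_pos hT, mul_inv_cancel_left₀ h0]
  have hfac : (m.factorial : ℂ) ≠ 0 := Nat.cast_ne_zero.2 m.factorial_ne_zero
  refine ⟨(m.factorial : ℂ)⁻¹ • permOp n d χ u, Submodule.smul_mem _ _ ?_, ?_⟩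
  · rw [mem_weightSpace_iff]
    refine ⟨⟨u, rfl⟩, mem_weightFun_permOp ?_ χ⟩
    rw [hu, LinearEquiv.apply_symm_apply]
    intro T hT
    by_contra h
    exact hT (if_neg h)
  · rw [map_smul, dualityMap_permOp b hχ, hu1, permOp_of_mem_range hv.1, smul_smul,
      inv_mul_cancel₀ hfac, one_smul]

theorem eq_zero_of_dualityMap_eq_zero {lam : Fin d → YoungDiagram}
    {b b' : Fin d → Fin m → Fin n × Fin n} (hb : ∀ i, IsBoxEnum (lam i).transpose (b i))
    (hb' : ∀ i, IsBoxEnum (lam i) (b' i)) {W : Submodule ℂ (TensorPow n d m)}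
    {v : TensorPow n d m} (hv : v ∈ highestWeightSpace W (conjTuple lam))
    (h0 : dualityMap b v = 0) : v = 0 := by
  rw [mem_highestWeightSpace_iff] at hv
  apply (rowCoord n d m).injective
  rw [map_zero]
  refine eq_zero_of_rowsSgnMap_mul_eq_zero hb hb' stabInv_pos hv.2 ?_
  rw [← rowCoord_dualityMap, h0, map_zero]

/-- The duality map as a linear map between (highest) weight spaces. -/
def weightDualityMap {lam : Fin d → YoungDiagram}
    {b : Fin d → Fin m → Fin n × Fin n} (hb : ∀ i, IsBoxEnum (lam i).transpose (b i))
    {χ χ' : Equiv.Perm (Fin m) →* ℤˣ} (hχ : ∀ w, χ' w = χ w * Equiv.Perm.sign w ^ d) :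
    weightSpace (LinearMap.range (permOp n d χ)) (conjTuple lam) →ₗ[ℂ]
      highestWeightSpace (LinearMap.range (permOp n d χ')) lam :=
  LinearMap.codRestrict _ (dualityMap b ∘ₗ Submodule.subtype _) fun v =>
    dualityMap_mem_highestWeightSpace hb hχ v.2.1

theorem weightDualityMap_inclusion_injective {lam : Fin d → YoungDiagram}
    {b b' : Fin d → Fin m → Fin n × Fin n} (hb : ∀ i, IsBoxEnum (lam i).transpose (b i))
    (hb' : ∀ i, IsBoxEnum (lam i) (b' i))
    {χ χ' : Equiv.Perm (Fin m) →* ℤˣ} (hχ : ∀ w, χ' w = χ w * Equiv.Perm.sign w ^ d) :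
    Function.Injective (weightDualityMap hb hχ ∘ₗ
      Submodule.inclusion (highestWeightSpace_le _ _)) := by
  refine injective_of_forall_eq_zero fun v hv => ?_
  exact Subtype.ext (eq_zero_of_dualityMap_eq_zero hb hb' v.2 (congrArg Subtype.val hv))

/-- Since `χ = χ' · sgn^d` as well, the injectivity result for the conjugate shapes gives an
injection in the opposite direction, and both spaces are finite-dimensional. -/
theorem weightDualityMap_inclusion_bijective {lam : Fin d → YoungDiagram}
    {b b' : Fin d → Fin m → Fin n × Fin n} (hb : ∀ i, IsBoxEnum (lam i).transpose (b i))
    (hb' : ∀ i, IsBoxEnum (lam i) (b' i))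
    {χ χ' : Equiv.Perm (Fin m) →* ℤˣ} (hχ : ∀ w, χ' w = χ w * Equiv.Perm.sign w ^ d) :
    Function.Bijective (weightDualityMap hb hχ ∘ₗ
      Submodule.inclusion (highestWeightSpace_le _ _)) := by
  have : Module.Finite ℂ (TensorPow n d m) := Module.Finite.of_basis (tableBasis n d m)
  have hinj := weightDualityMap_inclusion_injective hb hb' hχ
  have hχ' : ∀ w, χ w = χ' w * Equiv.Perm.sign w ^ d := fun w => by
    rw [hχ, mul_assoc, Int.units_mul_self, mul_one]
  have hconj : conjTuple (conjTuple lam) = lam :=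
    funext fun i => (lam i).transpose_transpose
  -- Only the existence of an injection is kept, so that `λ'' = λ` can be substituted in its type.
  have hinj' : ∃ g : highestWeightSpace (LinearMap.range (permOp n d χ'))
      (conjTuple (conjTuple lam)) →ₗ[ℂ] highestWeightSpace (LinearMap.range (permOp n d χ))
        (conjTuple lam), Function.Injective g :=
    ⟨_, weightDualityMap_inclusion_injective (lam := conjTuple lam) (b := b') (b' := b)
      (fun i => by rw [conjTuple, YoungDiagram.transpose_transpose]; exact hb' i) hb hχ'⟩
  rw [hconj] at hinj'
  obtain ⟨g, hg⟩ := hinj'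
  have hfin := module_finite_submodule (highestWeightSpace (LinearMap.range (permOp n d χ')) lam)
  have hfin' := module_finite_submodule
    (highestWeightSpace (LinearMap.range (permOp n d χ)) (conjTuple lam))
  exact bijective_of_injective_of_injective hinj hg

/-! ### Spanning by indexed vectors, uniqueness, and the combined duality statement -/

theorem weightSpace_le_span {lam : Fin d → YoungDiagram} {χ : Equiv.Perm (Fin m) →* ℤˣ}
    {I : Set (Table n d m)}
    (hI : ∀ T ∈ tablesN n m lam, permOp n d χ (tableBasis n d m T) = 0 ∨
      ∃ w : Equiv.Perm (Fin m), T ∘ w ∈ I) :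
    weightSpace (LinearMap.range (permOp n d χ)) lam ≤
      Submodule.span ℂ ((fun T => permOp n d χ (tableBasis n d m T)) '' I) := by
  intro v hv
  rw [mem_weightSpace_iff] at hv
  have hfac : (m.factorial : ℂ) ≠ 0 := Nat.cast_ne_zero.2 m.factorial_ne_zero
  -- Since `permOp n d χ v = m! v`, expanding `v` in the table basis writes `m! v` through the
  -- projected basis vectors, and reordering columns changes these only by a sign.
  rw [← Submodule.smul_mem_iff _ hfac, ← permOp_of_mem_range hv.1,
    ← (tableBasis n d m).sum_repr v, map_sum]
  refine Submodule.sum_mem _ fun T _ => ?_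
  rw [map_smul]
  by_cases h : (tableBasis n d m).repr v T = 0
  · rw [h, zero_smul]; exact zero_mem _
  · refine Submodule.smul_mem _ _ ?_
    have hT : T ∈ tablesN n m lam := hv.2 (fun i k => T k i) (by rwa [rowCoord_apply])
    rcases hI T hT with h0 | ⟨w, hw⟩
    · rw [h0]; exact zero_mem _
    · have : permOp n d χ (tableBasis n d m T) =
          ((χ w : ℤ) : ℂ) • permOp n d χ (tableBasis n d m (T ∘ w)) := by
        rw [permOp_tableBasis_comp, smul_smul, int_units_mul_self_cast, one_smul]
      rw [this]
      exact Submodule.smul_mem _ _ (Submodule.subset_span ⟨_, hw, rfl⟩)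

theorem IsIndexMap.unique {P Q : Submodule ℂ (TensorPow n d m)} {I : Set (Table n d m)}
    {e f : Table n d m → TensorPow n d m} (hP : P ≤ Submodule.span ℂ (e '' I))
    {Φ Ψ : P →ₗ[ℂ] Q} (hΦ : IsIndexMap I e f Φ) (hΨ : IsIndexMap I e f Ψ) : Ψ = Φ := by
  have key : ∀ v ∈ Submodule.span ℂ (e '' I), ∃ h : v ∈ P, Ψ ⟨v, h⟩ = Φ ⟨v, h⟩ := by
    intro v hv
    induction hv using Submodule.span_induction with
    | mem x hx =>
      obtain ⟨T, hT, rfl⟩ := hx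
      obtain ⟨h, h1⟩ := hΦ T hT
      obtain ⟨_, h2⟩ := hΨ T hT
      exact ⟨h, Subtype.ext (h2.trans h1.symm)⟩
    | zero => exact ⟨zero_mem _, (map_zero Ψ).trans (map_zero Φ).symm⟩
    | add x y _ _ hx hy =>
      obtain ⟨hx, ex⟩ := hx
      obtain ⟨hy, ey⟩ := hy
      refine ⟨add_mem hx hy, ?_⟩
      have e1 := map_add Ψ ⟨x, hx⟩ ⟨y, hy⟩
      have e2 := map_add Φ ⟨x, hx⟩ ⟨y, hy⟩
      rw [ex, ey] at e1
      exact e1.trans e2.symm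
    | smul a x _ hx =>
      obtain ⟨hx, ex⟩ := hx
      refine ⟨Submodule.smul_mem _ _ hx, ?_⟩
      have e1 := map_smul Ψ a ⟨x, hx⟩
      have e2 := map_smul Φ a ⟨x, hx⟩
      rw [ex] at e1
      exact e1.trans e2.symm
  refine LinearMap.ext fun v => ?_
  obtain ⟨_, h⟩ := key v.1 (hP v.2)
  exact h

/-- The common form of the four cases. The alternative in `hI` covers both index sets: a table with
repeated columns may have a vanishing projection instead of a representative in `I`. -/
theorem exists_duality (lam : Fin d → YoungDiagram)
    (hcard : ∀ i, (lam i).card = m) (hlen : ∀ i, (lam i).colLen 0 ≤ n)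
    (hlen' : ∀ i, (conjTuple lam i).colLen 0 ≤ n)
    {χ χ' : Equiv.Perm (Fin m) →* ℤˣ} (hχ : ∀ w, χ' w = χ w * Equiv.Perm.sign w ^ d)
    {I : Set (Table n d m)} {f : Table n d m → TensorPow n d m}
    (hIsub : I ⊆ tablesN n m (conjTuple lam))
    (hI : ∀ T ∈ tablesN n m (conjTuple lam), permOp n d χ (tableBasis n d m T) = 0 ∨
      ∃ w : Equiv.Perm (Fin m), T ∘ w ∈ I)
    (hf : ∀ b : Fin d → Fin m → Fin n × Fin n, (∀ i, IsBoxEnum (lam i).transpose (b i)) →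
      ∀ T ∈ tablesN n m (conjTuple lam),
        f T = permOp n d χ' (dualityMap b (tableBasis n d m T))) :
    ∃ Φ : weightSpace (LinearMap.range (permOp n d χ)) (conjTuple lam) →ₗ[ℂ]
        highestWeightSpace (LinearMap.range (permOp n d χ')) lam,
      IsIndexMap I (fun T => permOp n d χ (tableBasis n d m T)) f Φ ∧
      (∀ Ψ, IsIndexMap I (fun T => permOp n d χ (tableBasis n d m T)) f Ψ → Ψ = Φ) ∧
      Function.Surjective Φ ∧
      Function.Bijective (Φ ∘ₗ Submodule.inclusion (highestWeightSpace_le _ _)) := by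
  have hb' : ∀ i, ∃ b : Fin m → Fin n × Fin n, IsBoxEnum (lam i) b := fun i =>
    exists_isBoxEnum _ (hcard i) (hlen i) (by simpa [conjTuple] using hlen' i)
  have hb : ∀ i, ∃ b : Fin m → Fin n × Fin n, IsBoxEnum (lam i).transpose b := fun i =>
    exists_isBoxEnum _ (by
      rw [← hcard i]
      exact Finset.card_map _) (hlen' i)
      (by simpa using hlen i)
  choose b' hb' using hb'
  choose b hb using hb
  have hindex : IsIndexMap I (fun T => permOp n d χ (tableBasis n d m T)) f
      (weightDualityMap hb hχ) := by
    intro T hT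
    refine ⟨mem_weightSpace_iff.2 ⟨⟨_, rfl⟩, mem_weightFun_permOp ?_ χ⟩, ?_⟩
    · rw [rowCoord_tableBasis]
      intro X hX
      have hX' : X = fun i k => T k i := by
        by_contra h
        exact hX (Pi.single_eq_of_ne h _)
      rw [hX']
      exact hIsub hT
    · rw [hf b hb T (hIsub hT), ← dualityMap_permOp b hχ]
      rfl
  refine ⟨weightDualityMap hb hχ, hindex,
    fun Ψ hΨ => IsIndexMap.unique (weightSpace_le_span hI) hindex hΨ, fun v => ?_,
    weightDualityMap_inclusion_bijective hb hb' hχ⟩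
  obtain ⟨u, hu, huv⟩ := exists_dualityMap_eq hb hχ v.2
  exact ⟨⟨u, hu⟩, Subtype.ext huv⟩

theorem exists_comp_isLex (T : Table n d m) : ∃ w : Equiv.Perm (Fin m), IsLex (T ∘ w) :=
  ⟨Tuple.sort fun k => toLex (T k), Tuple.monotone_sort fun k => toLex (T k)⟩

theorem comp_mem_tablesN {lam : Fin d → YoungDiagram} {T : Table n d m}
    (hT : T ∈ tablesN n m lam) (w : Equiv.Perm (Fin m)) : T ∘ w ∈ tablesN n m lam := by
  intro i j
  rw [← hT i j]
  refine Finset.card_bij (fun k _ => w k) ?_ ?_ ?_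
  · intro k hk
    simpa using hk
  · intro k _ l _ h
    exact w.injective h
  · intro k hk
    exact ⟨w.symm k, by simpa using hk, by simp⟩

theorem exists_comp_mem_lexTablesN {lam : Fin d → YoungDiagram} {T : Table n d m}
    (hT : T ∈ tablesN n m lam) : ∃ w : Equiv.Perm (Fin m), T ∘ w ∈ lexTablesN n m lam :=
  (exists_comp_isLex T).imp fun w hw => ⟨comp_mem_tablesN hT w, hw⟩

theorem permOp_sign_eq_zero_or_exists_comp_mem_lexTables01 {lam : Fin d → YoungDiagram}
    {T : Table n d m} (hT : T ∈ tablesN n m lam) :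
    permOp n d Equiv.Perm.sign (tableBasis n d m T) = 0 ∨
      ∃ w : Equiv.Perm (Fin m), T ∘ w ∈ lexTables01 n m lam := by
  by_cases hinj : Function.Injective T
  · exact Or.inr ((exists_comp_isLex T).imp fun w hw =>
      ⟨⟨comp_mem_tablesN hT w, hinj.comp w.injective⟩, hw⟩)
  · exact Or.inl (permOp_sign_tableBasis_eq_zero hinj)

end

end

theorem mainTheorem2 (n d m : ℕ) (lam : Fin d → YoungDiagram)
    (hcard : ∀ i, (lam i).card = m)
    (hlen : ∀ i, (lam i).colLen 0 ≤ n)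
    (hlen' : ∀ i, (conjTuple lam i).colLen 0 ≤ n) :
    (Odd d →
      (∃ Φ : weightSpace (altPow n d m) (conjTuple lam) →ₗ[ℂ]
            highestWeightSpace (symPow n d m) lam,
          IsIndexMap (lexTables01 n m (conjTuple lam)) wedgeVec (deltaVec lam) Φ ∧
          (∀ Ψ, IsIndexMap (lexTables01 n m (conjTuple lam)) wedgeVec (deltaVec lam) Ψ → Ψ = Φ) ∧
          Function.Surjective Φ ∧
          Function.Bijective (Φ ∘ₗ Submodule.inclusion
            (highestWeightSpace_le (altPow n d m) (conjTuple lam)))) ∧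
      (∃ Φ : weightSpace (symPow n d m) (conjTuple lam) →ₗ[ℂ]
            highestWeightSpace (altPow n d m) lam,
          IsIndexMap (lexTablesN n m (conjTuple lam)) veeVec (nablaVec lam) Φ ∧
          (∀ Ψ, IsIndexMap (lexTablesN n m (conjTuple lam)) veeVec (nablaVec lam) Ψ → Ψ = Φ) ∧
          Function.Surjective Φ ∧
          Function.Bijective (Φ ∘ₗ Submodule.inclusion
            (highestWeightSpace_le (symPow n d m) (conjTuple lam))))) ∧
    (Even d →
      (∃ Φ : weightSpace (symPow n d m) (conjTuple lam) →ₗ[ℂ]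
            highestWeightSpace (symPow n d m) lam,
          IsIndexMap (lexTablesN n m (conjTuple lam)) veeVec (deltaVec lam) Φ ∧
          (∀ Ψ, IsIndexMap (lexTablesN n m (conjTuple lam)) veeVec (deltaVec lam) Ψ → Ψ = Φ) ∧
          Function.Surjective Φ ∧
          Function.Bijective (Φ ∘ₗ Submodule.inclusion
            (highestWeightSpace_le (symPow n d m) (conjTuple lam)))) ∧
      (∃ Φ : weightSpace (altPow n d m) (conjTuple lam) →ₗ[ℂ]
            highestWeightSpace (altPow n d m) lam,
          IsIndexMap (lexTables01 n m (conjTuple lam)) wedgeVec (nablaVec lam) Φ ∧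
          (∀ Ψ, IsIndexMap (lexTables01 n m (conjTuple lam)) wedgeVec (nablaVec lam) Ψ → Ψ = Φ) ∧
          Function.Surjective Φ ∧
          Function.Bijective (Φ ∘ₗ Submodule.inclusion
            (highestWeightSpace_le (altPow n d m) (conjTuple lam))))) := by
  have hsym : symPow n d m = LinearMap.range (permOp n d 1) := by
    rw [symPow, symOp_eq_permOp]
  have halt : altPow n d m = LinearMap.range (permOp n d Equiv.Perm.sign) := by
    rw [altPow, altOp_eq_permOp]
  have hvee : (veeVec : Table n d m → _) = fun T => permOp n d 1 (tableBasis n d m T) :=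
    funext veeVec_eq
  have hwedge : (wedgeVec : Table n d m → _) =
      fun T => permOp n d Equiv.Perm.sign (tableBasis n d m T) := funext wedgeVec_eq
  have heven : Even d → ∀ w : Equiv.Perm (Fin m), Equiv.Perm.sign w ^ d = 1 := by
    rintro ⟨k, rfl⟩ w
    rw [pow_add, Int.units_mul_self]
  have hodd : Odd d → ∀ w : Equiv.Perm (Fin m),
      Equiv.Perm.sign w ^ d = Equiv.Perm.sign w := by
    rintro ⟨k, rfl⟩ w
    rw [pow_succ, pow_mul, Int.units_sq, one_pow, one_mul]
  rw [hvee, hwedge, hsym, halt]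
  -- The pairs `(χ, χ')` are, in order, `(sgn, 1)` and `(1, sgn)` for odd `d`, then `(1, 1)` and
  -- `(sgn, sgn)` for even `d`.
  refine ⟨fun hd => ⟨?_, ?_⟩, fun hd => ⟨?_, ?_⟩⟩
  · exact exists_duality lam hcard hlen hlen'
      (fun w => by rw [hodd hd, Int.units_mul_self, MonoidHom.one_apply])
      (fun T hT => hT.1.1) (fun T hT => permOp_sign_eq_zero_or_exists_comp_mem_lexTables01 hT)
      fun b hb T hT => deltaVec_eq hb hT
  · exact exists_duality lam hcard hlen hlen'
      (fun w => by rw [hodd hd, MonoidHom.one_apply, one_mul])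
      (fun T hT => hT.1) (fun T hT => Or.inr (exists_comp_mem_lexTablesN hT))
      fun b hb T hT => nablaVec_eq hb hT
  · exact exists_duality lam hcard hlen hlen'
      (fun w => by rw [heven hd, mul_one])
      (fun T hT => hT.1) (fun T hT => Or.inr (exists_comp_mem_lexTablesN hT))
      fun b hb T hT => deltaVec_eq hb hT
  · exact exists_duality lam hcard hlen hlen'
      (fun w => by rw [heven hd, mul_one])
      (fun T hT => hT.1.1) (fun T hT => permOp_sign_eq_zero_or_exists_comp_mem_lexTables01 hT)
      fun b hb T hT => nablaVec_eq hb hT
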